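/- Strings are finite sequences over a finite ordered alphabet, and $n=|w|$ is the length of a nonempty string $w$. **L-systems.** An L-system is a tuple $(\Sigma,\varphi,\tau,s,d,n)$ with a finite alphabet $\Sigma$, a non-erasing endomorphism $\varphi$ of $\Sigma^*$, a coding $\tau:\Sigma\to\Sigma$, an axiom $s\in\Sigma^+$ and $d,n\ge 0$; it generates $\tau(\varphi^d(s))[1:n]$ (where $|\varphi^d(s)|\ge n$), and its size is $\sum_{a\in\Sigma}|\varphi(a)|+|s|+|\Sigma|+2$. Fix an integer $K\ge 1$. The measure $\ell(w)$ is the size of the smallest L-system with $d\le n^K$ generating $w$. **NU-systems.** A NU-system is a tuple $(V,R,\tau,s,d,n)$ like an L-system, but the (nonempty) right-hand sides of its rules may also contain extraction symbols $a(k)[i:j]$ with $a\in V$, $k\le n$ and $1\le i\le j\le n$, each counted with length $4$ in the size. Such a symbol stands for $\tau(\varphi^k(a)[i:j])$, where $\varphi$ is the morphism that the rules define when all extraction symbols are resolved; this resolution must be possible without loops. The measure $\nu(w)$ is the size of the smallest NU-system with $d\le n^K$ such that $\tau(\varphi^d(s))[1:n]=w$. **Other measures.** - $\delta(w)=\max_{1\le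 k\le n}P_w(k)/k$, where $P_w(k)$ is the number of distinct substrings of $w$ of length $k$. - $\gamma(w)$ is the size of the smallest string attractor: a set of positions of $w$ such that every nonempty substring has an occurrence in $w$ containing one of them. - $b(w)$ is the number of phrases of the smallest bidirectional macro scheme: a factorization of $w$ into nonempty phrases, where each phrase of length greater than $1$ is a copy of another substring of $w$, each phrase of length $1$ is given explicitly, and following the copies from any position ends at an explicit symbol. - $z,z_{no},z_e,v$ are the numbers of phrases of greedy left-to-right parsings, in which each phrase is the longest prefix of the rest of $w$ that has an admissible copy, or a single explicit symbol if there is none. Admissible copies are: for $z$, those starting before the current phrase; for $z_{no}$, those contained in the concatenation of the previous phrases; for $z_e$, those ending where a previous phrase ends; for $v$ (the lex-parse), those at the beginning of a suffix of $w$ that is lexicographically smaller than the suffix starting at the current phrase. - $g$, $g_{rl}$ and $c$ are the sizes (sums of the lengths of right-hand sides) of the smallest straight-line program (acyclic grammar with one rule per variable and nonempty right-hand sides), the smallest run-length straight-line program (also rules $A\to x^k$ with $k>1$, of size $2$), and the smallest collage system (also rules, of size $2$, that take the prefix or the suffix of a given length $t\ge 1$ of the expansion of a symbol) generating $w$. -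 $r$ is the number of runs of equal symbols in the Burrows-Wheeler transform of $w$, the sequence of the last symbols of the lexicographically sorted rotations of $w$. **Theorem.** For every $K\ge1$ and every measure $\mu\in\{\delta,\gamma,b,v,c,g_{rl},z,z_{no},z_e,r\}$, $\ell$ is asymptotically incomparable with $\mu$: there is a family of strings $(w_k)_{k\ge 0}$ over a fixed finite alphabet, with $|w_k|\to\infty$, in which $\ell=o(\mu)$, and there is another such family in which $\mu=o(\ell)$. Moreover $\ell=O(g)$ and $\ell=\Omega(\nu)$: there are constants $C,c'>0$ (which may depend on $K$) such that $\ell(w)\le C\,g(w)$ and $\ell(w)\ge c'\,\nu(w)$ for all nonempty strings $w$ over all alphabets. -/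

import Mathlib

open Filter Asymptotics
open scoped NNReal

/-! Symbols are natural numbers (with their usual order), strings are finite lists of symbols, and
an alphabet is a finite set of symbols. Positions are counted from `0` in the code. -/

namespace Repet

/-- A string. -/
abbrev Str := List ℕ

/-! ### Substring complexity and string attractors -/

/-- The number of distinct substrings of length `k` of `w`, for `k ≤ |w|`. -/
def complexity (w : Str) (k : ℕ) : ℕ :=
  ((Finset.range (w.length + 1 - k)).image fun i => (w.drop i).take k).card

/-- The maximum of `P_w(k) / k` over `1 ≤ k ≤ |w|`. -/
noncomputable def delta (w : Str) : ℝ :=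
  (((Finset.Icc 1 w.length).sup fun k => (complexity w k : ℝ≥0) / (k : ℝ≥0) : ℝ≥0) : ℝ)

/-- `A` is a string attractor of `w`: a set of positions of `w` such that every nonempty substring
`w[i .. i+m)` has an occurrence `w[i' .. i'+m)` that contains a position of `A`. -/
def IsAttractor (w : Str) (A : Finset ℕ) : Prop :=
  (∀ p ∈ A, p < w.length) ∧
  ∀ i m, 0 < m → i + m ≤ w.length →
    ∃ i', i' + m ≤ w.length ∧ (w.drop i').take m = (w.drop i).take m ∧
      ∃ p ∈ A, i' ≤ p ∧ p < i' + m

/-- The size of the smallest string attractor. -/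
noncomputable def gamma (w : Str) : ℕ :=
  sInf {k | ∃ A, IsAttractor w A ∧ A.card = k}

/-! ### Bidirectional macro schemes -/

/-- The pointer function of a parsing. A phrase is a pair (length, starting position of its
source); the phrases are laid out from left to right. A phrase of length `1` is an explicit symbol
(its second component is ignored, and there is no pointer); the position at offset `j` of a longer
phrase with source `q` points to `q + j`. -/
def pointer : List (ℕ × ℕ) → ℕ → Option ℕ
  | [], _ => none
  | (m, q) :: ps, j =>
      if j < m then (if m = 1 then none else some (q + j)) else pointer ps (j - m)

/-- `ps` is a bidirectional macro scheme for `w`: a parsing of `w` into nonempty phrases, where each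
phrase of length greater than `1` is a copy of its source (in particular the source lies inside
`w`), and following the pointers from any position ends at an explicit symbol. -/
def IsBMS (w : Str) (ps : List (ℕ × ℕ)) : Prop :=
  (∀ p ∈ ps, 0 < p.1) ∧ (ps.map Prod.fst).sum = w.length ∧
  (∀ j < w.length, ∀ j', pointer ps j = some j' → w[j']? = w[j]?) ∧
  (∀ j < w.length, ∃ k, (fun o : Option ℕ => o.bind (pointer ps))^[k] (some j) = none)

/-- The number of phrases of the smallest bidirectional macro scheme. -/
noncomputable def bms (w : Str) : ℕ :=
  sInf {k | ∃ ps, IsBMS w ps ∧ ps.length = k}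

/-! ### Greedy left-to-right parsings -/

/-- `ps` is the greedy parsing of `w` for the relation `Copy`, where `Copy w prev y` says that `y`
may be copied when the phrases before it are `prev`: every phrase is the longest prefix of the rest
of `w` that may be copied, or a single explicit symbol if no nonempty prefix may be copied. -/
def IsGreedyParse (Copy : Str → List Str → Str → Prop) (w : Str) (ps : List Str) : Prop :=
  ps.flatten = w ∧
  ∀ prev x post, ps = prev ++ x :: post →
    x ≠ [] ∧ (x.length = 1 ∨ Copy w prev x) ∧
    ∀ y, y <+: x ++ post.flatten → Copy w prev y → y.length ≤ x.length

/-- The number of phrases of the greedy parsing. -/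
noncomputable def greedySize (Copy : Str → List Str → Str → Prop) (w : Str) : ℕ :=
  sInf {k | ∃ ps, IsGreedyParse Copy w ps ∧ ps.length = k}

/-- Lempel-Ziv: `y` has a copy starting inside a previous phrase (overlaps are allowed). -/
noncomputable def lz (w : Str) : ℕ :=
  greedySize (fun w prev y => ∃ i < prev.flatten.length, y <+: w.drop i) w

/-- Lempel-Ziv without overlaps: `y` has a copy inside the concatenation of previous phrases. -/
noncomputable def lzNo (w : Str) : ℕ :=
  greedySize (fun _ prev y => y <:+: prev.flatten) w

/-- LZ-End: `y` has a copy that ends where some previous phrase ends. -/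
noncomputable def lzEnd (w : Str) : ℕ :=
  greedySize (fun _ prev y => ∃ q, q <+: prev ∧ y <:+ q.flatten) w

/-- Lex-parse: `y` has a copy starting at a suffix of `w` that is lexicographically smaller than
the suffix that starts at the current phrase. -/
noncomputable def lexParse (w : Str) : ℕ :=
  greedySize (fun w prev y => ∃ i < w.length,
    w.drop i < w.drop prev.flatten.length ∧ y <+: w.drop i) w

/-! ### Burrows-Wheeler transform -/

/-- The last symbols of the lexicographically sorted rotations of `w`. -/
def bwt (w : Str) : Str :=
  (((List.range w.length).map fun i => w.rotate i).insertionSort (· ≤ ·)).filterMap List.getLast?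

/-- The number of maximal runs of equal symbols in the Burrows-Wheeler transform. -/
def bwtRuns (w : Str) : ℕ := ((bwt w).destutter (· ≠ ·)).length

/-! ### Straight-line programs, run-length ones, and collage systems -/

/-- A terminal, or the variable with a given index. -/
inductive GSym
  | term (a : ℕ)
  | var (i : ℕ)

/-- The right-hand side of the rule of a variable: a sequence of symbols, a run `x^k`,
or the prefix or the suffix of length `t` of `x`. -/
inductive GRule
  | seq (xs : List GSym)
  | run (x : GSym) (k : ℕ)
  | truncL (x : GSym) (t : ℕ)
  | truncR (x : GSym) (t : ℕ)

/-- The expansion of a symbol, given the expansions of the variables `0, 1, 2, …`. -/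
def GSym.eval (env : List Str) : GSym → Str
  | .term a => [a]
  | .var i => env.getD i []

/-- The expansion of a right-hand side. -/
def GRule.eval (env : List Str) : GRule → Str
  | .seq xs => xs.flatMap (GSym.eval env)
  | .run x k => (List.replicate k (x.eval env)).flatten
  | .truncL x t => (x.eval env).take t
  | .truncR x t => (x.eval env).drop ((x.eval env).length - t)

/-- The symbols of a right-hand side. -/
def GRule.syms : GRule → List GSym
  | .seq xs => xs
  | .run x _ => [x]
  | .truncL x _ => [x]
  | .truncR x _ => [x]

/-- The length of a right-hand side; a run or a truncation is a symbol with a number. -/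
def GRule.size : GRule → ℕ
  | .seq xs => xs.length
  | .run _ _ => 2
  | .truncL _ _ => 2
  | .truncR _ _ => 2

/-- An ordinary context-free rule, not an empty one. -/
def GRule.IsPlain : GRule → Prop
  | .seq xs => xs ≠ []
  | _ => False

/-- A run-length rule `A → x^k` with `k > 1`. -/
def GRule.IsRun : GRule → Prop
  | .run _ k => 1 < k
  | _ => False

/-- A truncation rule. -/
def GRule.IsTrunc : GRule → Prop
  | .truncL _ t => 0 < t
  | .truncR _ t => 0 < t
  | _ => False

/-- A straight-line program: the `i`-th entry is the unique rule of the variable `i`, and the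
start variable is the last one. -/
abbrev Prog := List GRule

/-- The rule of a variable mentions only earlier variables. -/
def Prog.Acyclic (p : Prog) : Prop :=
  ∀ i r, p[i]? = some r → ∀ j, GSym.var j ∈ r.syms → j < i

/-- The expansions of all the variables. -/
def Prog.values (p : Prog) : List Str :=
  List.foldl (fun env (r : GRule) => env ++ [r.eval env]) [] p

/-- The program generates exactly `w`. -/
def Prog.Generates (p : Prog) (w : Str) : Prop :=
  p.Acyclic ∧ p.values.getLast? = some w

/-- The sum of the lengths of the right-hand sides. -/
def Prog.size (p : Prog) : ℕ := (p.map GRule.size).sum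

/-- The size of the smallest straight-line program (context-free grammar) for `w`. -/
noncomputable def slp (w : Str) : ℕ :=
  sInf {k | ∃ p : Prog, (∀ r ∈ p, r.IsPlain) ∧ p.Generates w ∧ p.size = k}

/-- The size of the smallest run-length straight-line program for `w`. -/
noncomputable def rlslp (w : Str) : ℕ :=
  sInf {k | ∃ p : Prog, (∀ r ∈ p, r.IsPlain ∨ r.IsRun) ∧ p.Generates w ∧ p.size = k}

/-- The size of the smallest collage system for `w`. -/
noncomputable def collage (w : Str) : ℕ :=
  sInf {k | ∃ p : Prog, (∀ r ∈ p, r.IsPlain ∨ r.IsRun ∨ r.IsTrunc) ∧ p.Generates w ∧ p.size = k}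

/-! ### L-systems -/

/-- The `d`-th power of the morphism given by the rules `φ`, applied to the string `s`. -/
def morphPow (φ : ℕ → Str) (d : ℕ) (s : Str) : Str :=
  (fun u : Str => u.flatMap φ)^[d] s

/-- The data of an L-system `(Σ, φ, τ, s, d, n)`; `rule` and `code` only matter on `alph`. -/
structure LSystem where
  alph : Finset ℕ
  rule : ℕ → Str
  code : ℕ → ℕ
  start : Str
  depth : ℕ
  len : ℕ

/-- The rules are a non-erasing endomorphism, the coding maps the alphabet to itself, and the
start string is a nonempty string over the alphabet. -/
def LSystem.Valid (L : LSystem) : Prop :=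
  (∀ a ∈ L.alph, L.rule a ≠ [] ∧ ∀ b ∈ L.rule a, b ∈ L.alph) ∧
  (∀ a ∈ L.alph, L.code a ∈ L.alph) ∧
  L.start ≠ [] ∧ ∀ a ∈ L.start, a ∈ L.alph

/-- `w = τ(φ^d(s))[1:n]`. -/
def LSystem.Generates (L : LSystem) (w : Str) : Prop :=
  L.len ≤ (morphPow L.rule L.depth L.start).length ∧
  w = ((morphPow L.rule L.depth L.start).map L.code).take L.len

/-- `size(φ) + |s| + |Σ| + 2`. -/
def LSystem.size (L : LSystem) : ℕ :=
  (∑ a ∈ L.alph, (L.rule a).length) + L.start.length + L.alph.card + 2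

/-- The size of the smallest L-system generating `w`, among those with `d ≤ n ^ K`. -/
noncomputable def ell (K : ℕ) (w : Str) : ℕ :=
  sInf {m | ∃ L : LSystem, L.Valid ∧ L.depth ≤ L.len ^ K ∧ L.Generates w ∧ L.size = m}

/-! ### NU-systems -/

/-- A symbol in a rule of a NU-system: a plain symbol, or an extraction `a(k)[i:j]`. -/
inductive NUSym
  | var (a : ℕ)
  | ext (a k i j : ℕ)

/-- Extraction symbols have length `4`. -/
def NUSym.weight : NUSym → ℕ
  | .var _ => 1
  | .ext _ _ _ _ => 4

/-- The data of a NU-system `(V, R, τ, s, d, n)`. -/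
structure NUSystem where
  alph : Finset ℕ
  rule : ℕ → List NUSym
  code : ℕ → ℕ
  start : Str
  depth : ℕ
  len : ℕ

/-- The symbol only uses letters of `V`, and the level and the interval of an extraction
are at most `n`. -/
def NUSym.Valid (V : Finset ℕ) (n : ℕ) : NUSym → Prop
  | .var a => a ∈ V
  | .ext a k i j => a ∈ V ∧ k ≤ n ∧ 1 ≤ i ∧ i ≤ j ∧ j ≤ n

/-- Well-formedness of the data of a NU-system. -/
def NUSystem.Valid (N : NUSystem) : Prop :=
  (∀ a ∈ N.alph, N.rule a ≠ [] ∧ ∀ x ∈ N.rule a, x.Valid N.alph N.len) ∧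
  (∀ a ∈ N.alph, N.code a ∈ N.alph) ∧
  N.start ≠ [] ∧ ∀ a ∈ N.start, a ∈ N.alph

/-- Apply partially known rules `f` (`none` is a symbol not known yet) to a partially known string.
Positions after an unknown symbol are lost, since the length of its image is unknown. -/
def partialStep (f : ℕ → List (Option ℕ)) : List (Option ℕ) → List (Option ℕ)
  | some a :: u => f a ++ partialStep f u
  | _ => []

/-- What is known of the string denoted by a symbol of a rule if `f` is what is known of the rules:
`a(k)[i:j]` is the image under the coding of the symbols `i, …, j` of the `k`-th level from `a`. -/
def NUSystem.partialSym (N : NUSystem) (f : ℕ → List (Option ℕ)) : NUSym → List (Option ℕ)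
  | .var a => [some a]
  | .ext a k i j => (List.range' i (j + 1 - i)).map fun p =>
      (((partialStep f)^[k] [some a])[p - 1]?).join.map N.code

/-- What is known of the right-hand sides after `t` rounds of resolving extractions. -/
def NUSystem.approx (N : NUSystem) : ℕ → ℕ → List (Option ℕ)
  | 0, _ => []
  | t + 1, a => (N.rule a).flatMap (N.partialSym (N.approx t))

/-- All extractions in the rules can be resolved without running into a loop (or outside a level),
and `φ` is the resulting morphism. -/
def NUSystem.Resolves (N : NUSystem) (φ : ℕ → Str) : Prop :=
  ∃ t, ∀ a ∈ N.alph, N.approx t a = (φ a).map some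

/-- The NU-system is free of loops and generates `w = τ(φ^d(s))[1:n]`, for its morphism `φ`. -/
def NUSystem.Generates (N : NUSystem) (w : Str) : Prop :=
  ∃ φ : ℕ → Str, N.Resolves φ ∧ N.len ≤ (morphPow φ N.depth N.start).length ∧
    w = ((morphPow φ N.depth N.start).map N.code).take N.len

/-- The size of a NU-system. -/
def NUSystem.size (N : NUSystem) : ℕ :=
  (∑ a ∈ N.alph, ((N.rule a).map NUSym.weight).sum) + N.start.length + N.alph.card + 2

/-- The size of the smallest NU-system generating `w`, among those with `d ≤ n ^ K`. -/
noncomputable def nu (K : ℕ) (w : Str) : ℕ :=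
  sInf {m | ∃ N : NUSystem, N.Valid ∧ N.depth ≤ N.len ^ K ∧ N.Generates w ∧ N.size = m}

/-! ### Asymptotic comparison -/

/-- There is a family of strings over a fixed finite alphabet, of lengths tending to infinity, in
which `f = o(g)`. -/
def SmallerOnSomeFamily (f g : Str → ℝ) : Prop :=
  ∃ (A : Finset ℕ) (w : ℕ → Str), (∀ k, ∀ a ∈ w k, a ∈ A) ∧
    Tendsto (fun k => (w k).length) atTop atTop ∧
    (fun k => f (w k)) =o[atTop] (fun k => g (w k))

/-- Neither measure bounds the other: each is asymptotically smaller on some family. -/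
def Incomparable (f g : Str → ℝ) : Prop :=
  SmallerOnSomeFamily f g ∧ SmallerOnSomeFamily g f

end Repet

namespace Repet

/-! Every measure `μ` in the list is bounded below by `δ`, so a single family serves for `ℓ = o(μ)`.
The morphism `0 → 01, 1 → 12, 2 → 2` has the levels `0 · 1 · 12 · 122 ⋯`, which cost a constant as
L-systems. A level contains quadratically many words of linear length of the form `2^x 1 2^i 1 2^y`,
so `δ` is unbounded on them. The lower bounds by `δ` come along three chains. Phrase starts of a
macro scheme form an attractor, and the greedy parsings are macro schemes, so `δ ≤ γ ≤ b` and `b` is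
at most each of `z`, `z_no`, `z_e`, `v`. A rule of a collage system adds at most `size · k` new
factors of length `k`, so `δ ≤ c ≤ g_rl`. The number of circular factors grows by at most `r - 1`
from one length to the next, so `δ ≤ r`.

The converse `μ = o(ℓ)` is a counting argument. A string `0^{2^{m+2}} 1 0^{k₁} 1 ⋯ 0^{k_m} 1` with
all `kᵢ` between `2` and `2^m + 1` has every `μ` at most `8(m + 1)`. There are `2^{m²}` such
strings, all of length at most `2^{2m+4}`. L-systems of size at most `s` are described by `O(s log
s)` bits together with `d` and `n`, which take only `O(Km)` bits because `d ≤ n^K`. With `m = k³`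
and `s = k⁴` there are fewer than `2^{k⁶}` descriptions for large `k` (`count_lt_two_pow`), so some
string has `ℓ > k⁴` while `μ = O(k³)`.

For `ℓ = O(g)`, a grammar becomes a morphism that fixes terminals and is iterated as many times as
there are variables. For `ν ≤ ℓ`, an L-system is a NU-system without extractions. -/

/-! ### Factors of a string -/

/-- The set of factors of length `k` of `w`. -/
def factors (w : Str) (k : ℕ) : Finset Str :=
  (Finset.range (w.length + 1 - k)).image fun i => (w.drop i).take k

theorem mem_factors_iff_exists {w u : Str} {k : ℕ} :
    u ∈ factors w k ↔ ∃ i, i + k ≤ w.length ∧ (w.drop i).take k = u := by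
  simp only [factors, Finset.mem_image, Finset.mem_range]
  constructor
  · rintro ⟨i, hi, h⟩; exact ⟨i, by omega, h⟩
  · rintro ⟨i, hi, h⟩; exact ⟨i, by omega, h⟩

theorem mem_factors {w u : Str} {k : ℕ} : u ∈ factors w k ↔ u <:+: w ∧ u.length = k := by
  rw [mem_factors_iff_exists]
  constructor
  · rintro ⟨i, hi, rfl⟩
    refine ⟨((List.take_prefix _ _).isInfix).trans (List.drop_suffix _ _).isInfix, ?_⟩
    simp; omega
  · rintro ⟨⟨s, t, rfl⟩, rfl⟩
    refine ⟨s.length, by simp, ?_⟩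
    simp [List.append_assoc]

theorem complexity_eq_card (w : Str) (k : ℕ) : complexity w k = (factors w k).card := rfl

theorem delta_le {w : Str} {M : ℕ}
    (h : ∀ k, 1 ≤ k → k ≤ w.length → (factors w k).card ≤ M * k) : delta w ≤ M := by
  have : ((Finset.Icc 1 w.length).sup fun k => (complexity w k : ℝ≥0) / (k : ℝ≥0)) ≤ (M : ℝ≥0) := by
    apply Finset.sup_le
    intro k hk
    rw [Finset.mem_Icc] at hk
    have hk0 : (0 : ℝ≥0) < k := by exact_mod_cast hk.1
    rw [div_le_iff₀ hk0, complexity_eq_card]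
    exact_mod_cast h k hk.1 hk.2
  have := NNReal.coe_le_coe.2 this
  simpa [delta] using this

theorem div_le_delta {w : Str} {k : ℕ} (h1 : 1 ≤ k) (h2 : k ≤ w.length) :
    ((factors w k).card : ℝ) / k ≤ delta w := by
  have := Finset.le_sup (f := fun k => (complexity w k : ℝ≥0) / (k : ℝ≥0))
    (Finset.mem_Icc.2 ⟨h1, h2⟩)
  have := NNReal.coe_le_coe.2 this
  simpa [delta, complexity_eq_card] using this

/-! ### Attractors -/

theorem isAttractor_range (w : Str) : IsAttractor w (Finset.range w.length) := by
  refine ⟨fun p hp => Finset.mem_range.1 hp, fun i m hm him => ⟨i, him, rfl, i, ?_, le_rfl, ?_⟩⟩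
  · rw [Finset.mem_range]; omega
  · omega

theorem exists_attractor (w : Str) : ∃ A, IsAttractor w A ∧ A.card = gamma w :=
  Nat.sInf_mem (s := {k | ∃ A, IsAttractor w A ∧ A.card = k}) ⟨_, _, isAttractor_range w, rfl⟩

theorem gamma_le {w : Str} {A : Finset ℕ} (h : IsAttractor w A) : gamma w ≤ A.card :=
  Nat.sInf_le ⟨A, h, rfl⟩

/-- A factor of length `k` is determined by an attractor position inside one of its occurrences and
the offset of that position, which is less than `k`. -/
theorem delta_le_gamma (w : Str) : delta w ≤ gamma w := by
  obtain ⟨A, hA, hc⟩ := exists_attractor w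
  rw [← hc]
  refine delta_le fun k hk _ => ?_
  have : factors w k ⊆ (A ×ˢ Finset.range k).image fun x => (w.drop (x.1 - x.2)).take k := by
    intro u hu
    obtain ⟨i, hi, rfl⟩ := mem_factors_iff_exists.1 hu
    obtain ⟨i', -, heq, p, hp, h1, h2⟩ := hA.2 i k hk hi
    refine Finset.mem_image.2 ⟨(p, p - i'), ?_, ?_⟩
    · simp [hp]; omega
    · rw [← heq]; congr 2; simp; omega
  calc _ ≤ _ := Finset.card_le_card this
    _ ≤ _ := Finset.card_image_le
    _ = _ := by simp

/-! ### Bidirectional macro schemes -/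

/-- The starting positions of the phrases of a parsing. -/
def phraseStarts : List (ℕ × ℕ) → Finset ℕ
  | [] => ∅
  | p :: ps => insert 0 ((phraseStarts ps).image (p.1 + ·))

theorem card_phraseStarts_le (ps : List (ℕ × ℕ)) : (phraseStarts ps).card ≤ ps.length := by
  induction ps with
  | nil => simp [phraseStarts]
  | cons p ps ih =>
    refine (Finset.card_insert_le _ _).trans ?_
    have := Finset.card_image_le (s := phraseStarts ps) (f := (p.1 + ·))
    simp only [List.length_cons]; omega

theorem lt_sum_of_mem_phraseStarts {ps : List (ℕ × ℕ)} (hp : ∀ p ∈ ps, 0 < p.1) {s : ℕ}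
    (hs : s ∈ phraseStarts ps) : s < (ps.map Prod.fst).sum := by
  induction ps generalizing s with
  | nil => simp [phraseStarts] at hs
  | cons p ps ih =>
    have h0 := hp p (by simp)
    simp only [phraseStarts, Finset.mem_insert, Finset.mem_image] at hs
    simp only [List.map_cons, List.sum_cons]
    rcases hs with rfl | ⟨t, ht, rfl⟩
    · omega
    · have := ih (fun p h => hp p (by simp [h])) ht
      omega

/-- A window without phrase starts lies inside one phrase and misses its first position. That phrase
is therefore longer than `1`, and its pointers shift the whole window by one common amount. -/
theorem exists_source_of_no_phraseStart {ps : List (ℕ × ℕ)} (hp : ∀ p ∈ ps, 0 < p.1) {i m : ℕ}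
    (hm : 0 < m) (him : i + m ≤ (ps.map Prod.fst).sum)
    (hs : ∀ s ∈ phraseStarts ps, i ≤ s → i + m ≤ s) :
    ∃ q, ∀ j < m, pointer ps (i + j) = some (q + j) := by
  induction ps generalizing i with
  | nil => simp at him; omega
  | cons p ps ih =>
    obtain ⟨L, q⟩ := p
    simp only [List.map_cons, List.sum_cons] at him
    simp only [phraseStarts, Finset.mem_insert, Finset.mem_image] at hs
    by_cases hi : L ≤ i
    · obtain ⟨r, hr⟩ := ih (fun p h => hp p (by simp [h])) (i := i - L) (by omega) (by
        intro s hs1 hs2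
        have := hs (L + s) (Or.inr ⟨s, hs1, rfl⟩) (by omega)
        omega)
      refine ⟨r, fun j hj => ?_⟩
      rw [← hr j hj, pointer, if_neg (by omega)]
      congr 1; omega
    · have h0 : i ≠ 0 := by
        rintro rfl
        have := hs 0 (Or.inl rfl) le_rfl
        omega
      have hL : i + m ≤ L := by
        by_contra hlt
        cases ps with
        | nil => simp at him; omega
        | cons p' ps' =>
          have := hs L (Or.inr ⟨0, by simp [phraseStarts], by simp⟩) (by omega)
          omega
      refine ⟨q + i, fun j hj => ?_⟩
      rw [pointer, if_pos (by omega), if_neg (by omega)]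
      congr 1; omega

theorem getElem?_eq_of_forall_lt_imp_take_eq {w : Str} {i q m : ℕ}
    (h : ∀ j < m, w[q + j]? = w[i + j]?) : (w.drop q).take m = (w.drop i).take m := by
  apply List.ext_getElem?
  intro j
  by_cases hj : j < m
  · simp [hj, List.getElem?_drop, h j hj]
  · simp [hj]

/-- As long as a window contains no phrase start, the pointers carry it to an equal window. Since
the chain from its first position terminates, some window on the way contains a phrase start. -/
theorem IsBMS.isAttractor {w : Str} {ps : List (ℕ × ℕ)} (h : IsBMS w ps) :
    IsAttractor w (phraseStarts ps) := by
  obtain ⟨hp, hsum, hcopy, hterm⟩ := h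
  refine ⟨fun p hp' => hsum ▸ lt_sum_of_mem_phraseStarts hp hp', ?_⟩
  have key : ∀ k i m, 0 < m → i + m ≤ w.length →
      (fun o : Option ℕ => o.bind (pointer ps))^[k] (some i) = none →
      ∃ i', i' + m ≤ w.length ∧ (w.drop i').take m = (w.drop i).take m ∧
        ∃ p ∈ phraseStarts ps, i' ≤ p ∧ p < i' + m := by
    intro k
    induction k with
    | zero => intro i m _ _ h; simp at h
    | succ k ih =>
      intro i m hm him hk
      by_cases hs : ∃ s ∈ phraseStarts ps, i ≤ s ∧ s < i + m
      · exact ⟨i, him, rfl, hs⟩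
      · push Not at hs
        obtain ⟨q, hq⟩ := exists_source_of_no_phraseStart hp hm (hsum ▸ him) hs
        have heq : ∀ j < m, w[q + j]? = w[i + j]? := fun j hj =>
          hcopy (i + j) (by omega) _ (hq j hj)
        have hqm : q + m ≤ w.length := by
          have h1 := heq (m - 1) (by omega)
          rw [List.getElem?_eq_getElem (l := w) (i := i + (m - 1)) (by omega)] at h1
          have := (List.getElem?_eq_some_iff.1 h1).1
          omega
        rw [Function.iterate_succ_apply] at hk
        have h0 := hq 0 hm
        simp only [add_zero] at h0
        simp only [Option.bind_some, h0] at hk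
        obtain ⟨i', h1, h2, h3⟩ := ih q m hm hqm hk
        exact ⟨i', h1, h2.trans (getElem?_eq_of_forall_lt_imp_take_eq heq), h3⟩
  intro i m hm him
  obtain ⟨k, hk⟩ := hterm i (by omega)
  exact key k i m hm him hk

theorem pointer_map_one (n j : ℕ) : pointer (List.replicate n (1, 0)) j = none := by
  induction n generalizing j with
  | zero => simp [pointer]
  | succ n ih => simp [List.replicate_succ, pointer, ih]

theorem exists_isBMS (w : Str) : ∃ ps, IsBMS w ps ∧ ps.length = bms w := by
  refine Nat.sInf_mem (s := {k | ∃ ps, IsBMS w ps ∧ ps.length = k})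
    ⟨_, List.replicate w.length (1, 0), ⟨?_, ?_, ?_, ?_⟩, rfl⟩
  · intro p hp; rw [List.eq_of_mem_replicate hp]; simp
  · simp
  · intro j _ j' h; simp [pointer_map_one] at h
  · intro j _; exact ⟨1, by simp [pointer_map_one]⟩

theorem gamma_le_bms (w : Str) : gamma w ≤ bms w := by
  obtain ⟨ps, hps, hl⟩ := exists_isBMS w
  exact hl ▸ (gamma_le hps.isAttractor).trans (card_phraseStarts_le ps)

/-- A parsing in which every phrase of length greater than `1` has a source such that some rank of
the positions decreases from the phrase to its source yields a bidirectional macro scheme. -/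
theorem bms_le_of_rank {w : Str} {ps : List Str} (hw : ps.flatten = w) (ρ : ℕ → ℕ)
    (h : ∀ prev x post, ps = prev ++ x :: post → x ≠ [] ∧ (x.length = 1 ∨
      ∃ i, x <+: w.drop i ∧ ∀ j < x.length, ρ (i + j) < ρ (prev.flatten.length + j))) :
    bms w ≤ ps.length := by
  have key : ∀ post prev, ps = prev ++ post → ∃ qs : List (ℕ × ℕ), qs.length = post.length ∧
      (∀ q ∈ qs, 0 < q.1) ∧ (qs.map Prod.fst).sum = post.flatten.length ∧
      ∀ j j', pointer qs j = some j' →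
        w[j']? = w[prev.flatten.length + j]? ∧ ρ j' < ρ (prev.flatten.length + j) := by
    intro post
    induction post with
    | nil => intro prev _; exact ⟨[], by simp [pointer]⟩
    | cons x post ih =>
      intro prev hps
      obtain ⟨qs, h1, h2, h3, h4⟩ := ih (prev ++ [x]) (by simp [hps])
      obtain ⟨hx, hc⟩ := h prev x post hps
      have hx0 : 0 < x.length := List.length_pos_iff.2 hx
      have hwx : w.drop prev.flatten.length = x ++ post.flatten := by
        rw [← hw, hps]; simp
      obtain ⟨i, hi⟩ : ∃ i, x.length ≠ 1 → x <+: w.drop i ∧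
          ∀ j < x.length, ρ (i + j) < ρ (prev.flatten.length + j) := by
        rcases hc with hc | ⟨i, hi⟩
        · exact ⟨0, fun h => absurd hc h⟩
        · exact ⟨i, fun _ => hi⟩
      refine ⟨(x.length, i) :: qs, by simp [h1], ?_, by simp [h3], ?_⟩
      · intro q hq
        rcases List.mem_cons.1 hq with rfl | hq
        · exact hx0
        · exact h2 q hq
      · intro j j' hj
        rw [pointer] at hj
        split_ifs at hj with hj1 hj2
        · obtain rfl := Option.some_injective _ hj
          obtain ⟨hp, hr⟩ := hi hj2
          refine ⟨?_, hr j hj1⟩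
          rw [← List.getElem?_drop, ← List.getElem?_drop, hwx]
          obtain ⟨t, ht⟩ := hp
          rw [← ht, List.getElem?_append_left hj1, List.getElem?_append_left hj1]
        · have := h4 _ _ hj
          simp only [List.flatten_append, List.flatten_cons, List.flatten_nil, List.append_nil,
            List.length_append] at this
          rwa [show prev.flatten.length + x.length + (j - x.length) = prev.flatten.length + j by
            omega] at this
  obtain ⟨qs, h1, h2, h3, h4⟩ := key ps [] rfl
  simp only [List.flatten_nil, List.length_nil, zero_add] at h4
  rw [← h1]
  refine Nat.sInf_le ⟨qs, ⟨h2, by rw [h3, hw], fun j _ j' hj => (h4 j j' hj).1, fun j _ => ?_⟩, rfl⟩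
  -- The rank drops strictly along each pointer, so every chain of pointers is finite.
  have term : ∀ N j, ρ j < N →
      ∃ k, (fun o : Option ℕ => o.bind (pointer qs))^[k] (some j) = none := by
    intro N
    induction N with
    | zero => intro j hj; omega
    | succ N ih =>
      intro j hj
      cases hq : pointer qs j with
      | none => exact ⟨1, by simp [hq]⟩
      | some j' =>
        obtain ⟨k, hk⟩ := ih j' (by have := (h4 j j' hq).2; omega)
        exact ⟨k + 1, by rw [Function.iterate_succ_apply]; simpa [hq] using hk⟩
  exact term _ j (Nat.lt_succ_self _)

/-! ### Greedy parsings -/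

/-- Without existence, `greedySize` could be the infimum of the empty set, which is `0`, and the
lower bounds on it would be lost. -/
theorem exists_isGreedyParse (Copy : Str → List Str → Str → Prop) (w : Str) :
    ∃ ps, IsGreedyParse Copy w ps := by
  classical
  have key : ∀ N prev rest, rest.length ≤ N → ∃ ps : List Str, ps.flatten = rest ∧
      ∀ pr x post, ps = pr ++ x :: post →
        x ≠ [] ∧ (x.length = 1 ∨ Copy w (prev ++ pr) x) ∧
        ∀ y, y <+: x ++ post.flatten → Copy w (prev ++ pr) y → y.length ≤ x.length := by
    intro N
    induction N with
    | zero =>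
      intro prev rest hr
      exact ⟨[], by simpa using (List.length_eq_zero_iff.1 (Nat.le_zero.1 hr)).symm, by simp⟩
    | succ N ih =>
      intro prev rest hr
      by_cases hrest : rest = []
      · exact ⟨[], by simp [hrest], by simp⟩
      have hlen : 0 < rest.length := List.length_pos_iff.2 hrest
      set P : ℕ → Prop := fun L => Copy w prev (rest.take L) with hP
      -- The value `0` means that no nonempty prefix may be copied; `max 1 L₀` then gives a single
      -- explicit symbol.
      set L₀ := Nat.findGreatest P rest.length with hL₀
      have hL₀' : L₀ ≤ rest.length := Nat.findGreatest_le _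
      obtain ⟨ps, h1, h2⟩ := ih (prev ++ [rest.take (max 1 L₀)]) (rest.drop (max 1 L₀))
        (by simp; omega)
      have hlx : (rest.take (max 1 L₀)).length = max 1 L₀ := by simp; omega
      refine ⟨rest.take (max 1 L₀) :: ps, by simp [h1], ?_⟩
      intro pr x post hps
      cases pr with
      | nil =>
        simp only [List.nil_append, List.cons.injEq] at hps
        obtain ⟨rfl, rfl⟩ := hps
        refine ⟨by rw [← List.length_pos_iff, hlx]; omega, ?_, ?_⟩
        · by_cases h0 : L₀ = 0
          · left; rw [hlx, h0]; rfl
          · right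
            rw [max_eq_right (by omega), List.append_nil]
            exact Nat.findGreatest_of_ne_zero (P := P) hL₀.symm h0
        · intro y hy hc
          rw [h1, List.take_append_drop] at hy
          rw [List.append_nil] at hc
          have hPy : P y.length := by
            rw [hP]; simp only; rwa [← List.prefix_iff_eq_take.1 hy]
          have := Nat.le_findGreatest hy.length_le hPy
          rw [hlx]; omega
      | cons z pr =>
        simp only [List.cons_append, List.cons.injEq] at hps
        obtain ⟨rfl, rfl⟩ := hps
        simpa using h2 pr x post rfl
  obtain ⟨ps, h1, h2⟩ := key w.length [] w le_rfl
  exact ⟨ps, h1, by simpa using h2⟩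

theorem exists_greedySize_eq (Copy : Str → List Str → Str → Prop) (w : Str) :
    ∃ ps, IsGreedyParse Copy w ps ∧ ps.length = greedySize Copy w := by
  obtain ⟨ps, h⟩ := exists_isGreedyParse Copy w
  exact Nat.sInf_mem (s := {k | ∃ ps, IsGreedyParse Copy w ps ∧ ps.length = k}) ⟨_, ps, h, rfl⟩

theorem bms_le_greedySize (Copy : Str → List Str → Str → Prop) (w : Str) (ρ : ℕ → ℕ)
    (h : ∀ prev x, x ≠ [] → x <+: w.drop prev.flatten.length → Copy w prev x →
      ∃ i, x <+: w.drop i ∧ ∀ j < x.length, ρ (i + j) < ρ (prev.flatten.length + j)) :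
    bms w ≤ greedySize Copy w := by
  obtain ⟨ps, ⟨h1, h2⟩, hl⟩ := exists_greedySize_eq Copy w
  rw [← hl]
  refine bms_le_of_rank h1 ρ fun prev x post hps => ?_
  obtain ⟨hx, hc, -⟩ := h2 prev x post hps
  refine ⟨hx, hc.imp_right fun hc => h prev x hx ?_ hc⟩
  rw [← h1, hps]
  simp

theorem bms_le_lz (w : Str) : bms w ≤ lz w := by
  refine bms_le_greedySize _ w id fun prev x _ _ ⟨i, hi, hx⟩ => ⟨i, hx, fun j _ => ?_⟩
  simp only [id]; omega

theorem exists_earlier_of_infix {w s x : Str} (hx : x ≠ []) (hs : s <+: w) (hxs : x <:+: s) :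
    ∃ i < s.length, x <+: w.drop i := by
  obtain ⟨a, b, rfl⟩ := hxs
  obtain ⟨t, rfl⟩ := hs
  refine ⟨a.length, ?_, b ++ t, by simp [List.append_assoc]⟩
  have := List.length_pos_iff.2 hx
  simp; omega

theorem bms_le_greedySize_of_infix (Copy : Str → List Str → Str → Prop) (w : Str)
    (h : ∀ prev x, Copy w prev x → x <:+: prev.flatten) : bms w ≤ greedySize Copy w := by
  obtain ⟨ps, ⟨h1, h2⟩, hl⟩ := exists_greedySize_eq Copy w
  rw [← hl]
  refine bms_le_of_rank h1 id fun prev x post hps => ?_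
  obtain ⟨hx, hc, -⟩ := h2 prev x post hps
  refine ⟨hx, hc.imp_right fun hc => ?_⟩
  obtain ⟨i, hi, hxi⟩ := exists_earlier_of_infix (w := w) hx
    (by rw [← h1, hps]; simp) (h prev x hc)
  exact ⟨i, hxi, fun j _ => by simp only [id]; omega⟩

theorem bms_le_lzNo (w : Str) : bms w ≤ lzNo w :=
  bms_le_greedySize_of_infix _ w fun _ _ h => h

theorem bms_le_lzEnd (w : Str) : bms w ≤ lzEnd w := by
  refine bms_le_greedySize_of_infix _ w fun prev x ⟨q, ⟨t, hq⟩, hx⟩ => ?_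
  refine hx.isInfix.trans ?_
  rw [← hq, List.flatten_append]
  exact (List.prefix_append _ _).isInfix

theorem lt_of_append_lt_append_left {x s t : Str} (h : x ++ s < x ++ t) : s < t := by
  induction x with
  | nil => exact h
  | cons a x ih =>
    rcases List.cons_lt_cons_iff.1 h with h | ⟨-, h⟩
    · exact absurd h (lt_irrefl _)
    · exact ih h

/-- The rank of a position is the number of suffixes smaller than the one starting there. Stripping
the same prefix from two suffixes preserves their order, so the rank drops from every position of a
phrase to its source, not only from the first. -/
theorem bms_le_lexParse (w : Str) : bms w ≤ lexParse w := by
  refine bms_le_greedySize _ w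
    (fun p => ((Finset.range w.length).filter fun i => w.drop i < w.drop p).card) ?_
  rintro prev x - hx ⟨i, hi, hlt, hxi⟩
  refine ⟨i, hxi, fun j hj => ?_⟩
  obtain ⟨s, hs⟩ := hxi
  obtain ⟨t, ht⟩ := hx
  have hij : w.drop (i + j) < w.drop (prev.flatten.length + j) := by
    rw [← List.drop_drop, ← List.drop_drop]
    apply lt_of_append_lt_append_left (x := x.take j)
    have e1 : x.take j ++ (w.drop i).drop j = w.drop i := by
      rw [← hs, List.drop_append_of_le_length hj.le, ← List.append_assoc, List.take_append_drop]
    have e2 : x.take j ++ (w.drop prev.flatten.length).drop j = w.drop prev.flatten.length := by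
      rw [← ht, List.drop_append_of_le_length hj.le, ← List.append_assoc, List.take_append_drop]
    rwa [e1, e2]
  apply Finset.card_lt_card
  rw [Finset.ssubset_iff_of_subset]
  · refine ⟨i + j, ?_, by simp⟩
    have : x.length ≤ (w.drop i).length := by rw [← hs]; simp
    rw [List.length_drop] at this
    simp only [Finset.mem_filter, Finset.mem_range]
    exact ⟨by omega, hij⟩
  · intro p hp
    simp only [Finset.mem_filter] at hp ⊢
    exact ⟨hp.1, hp.2.trans hij⟩

/-! ### Collage systems -/

theorem factors_mono {u v : Str} (h : u <:+: v) (k : ℕ) : factors u k ⊆ factors v k := by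
  intro x hx
  rw [mem_factors] at hx ⊢
  exact ⟨hx.1.trans h, hx.2⟩

theorem factors_nil {k : ℕ} (hk : 0 < k) : factors [] k = ∅ := by
  ext u
  simp only [mem_factors, List.infix_nil, Finset.notMem_empty, iff_false, not_and]
  rintro rfl h
  simp at h; omega

/-- The windows of length `k` that cross the boundary between `l` and `r`. -/
def crossing (l r : Str) (k : ℕ) : Finset Str :=
  (Finset.Ico 1 k).image fun j => ((l ++ r).drop (l.length - j)).take k

theorem card_crossing_le (l r : Str) (k : ℕ) : (crossing l r k).card ≤ k - 1 :=
  Finset.card_image_le.trans (by simp)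

/-- Crossing windows are read off a fixed extension `r'` of `r`, so that all powers in a run can
share one set of at most `k - 1` windows. -/
theorem factors_append_subset {l r r' : Str} (hr : r <+: r') (k : ℕ) :
    factors (l ++ r) k ⊆ factors l k ∪ factors r k ∪ crossing l r' k := by
  intro u hu
  obtain ⟨i, hi, rfl⟩ := mem_factors_iff_exists.1 hu
  rw [List.length_append] at hi
  simp only [Finset.mem_union]
  by_cases h1 : i + k ≤ l.length
  · left; left
    refine mem_factors_iff_exists.2 ⟨i, h1, ?_⟩
    rw [List.drop_append_of_le_length (by omega), List.take_append_of_le_length (by simp; omega)]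
  by_cases h2 : l.length ≤ i
  · left; right
    refine mem_factors_iff_exists.2 ⟨i - l.length, by omega, ?_⟩
    rw [List.drop_append, List.drop_eq_nil_of_le h2, List.nil_append]
  · right
    refine Finset.mem_image.2 ⟨l.length - i, by simp; omega, ?_⟩
    obtain ⟨t, rfl⟩ := hr
    rw [show l.length - (l.length - i) = i by omega, ← List.append_assoc,
      List.drop_append_of_le_length (l₁ := l ++ r) (by simp; omega),
      List.take_append_of_le_length (by simp; omega)]

/-- The factors of length `k` of the strings of `env`. -/
def envFactors (env : List Str) (k : ℕ) : Finset Str :=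
  env.foldr (fun v F => factors v k ∪ F) ∅

theorem mem_envFactors {env : List Str} {k : ℕ} {u : Str} :
    u ∈ envFactors env k ↔ ∃ v ∈ env, u ∈ factors v k := by
  induction env with
  | nil => simp [envFactors]
  | cons v env ih =>
    have : envFactors (v :: env) k = factors v k ∪ envFactors env k := rfl
    simp [this, ih]

theorem card_factors_sym_sdiff_le (env : List Str) {k : ℕ} (hk : 0 < k) (x : GSym) :
    (factors (x.eval env) k \ envFactors env k).card ≤ 1 := by
  cases x with
  | term a =>
    refine (Finset.card_le_card Finset.sdiff_subset).trans (Finset.card_image_le.trans ?_)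
    simp [GSym.eval]; omega
  | var i =>
    rw [Finset.card_eq_zero.2]
    · simp
    rw [Finset.sdiff_eq_empty_iff_subset]
    intro u hu
    simp only [GSym.eval, List.getD] at hu
    cases h : env[i]? with
    | none => rw [h] at hu; simp [factors_nil hk] at hu
    | some v =>
      rw [h] at hu
      exact mem_envFactors.2 ⟨v, List.mem_of_getElem? h, by simpa using hu⟩

theorem card_sdiff_le_add_add {A B C D F : Finset Str} (h : A ⊆ B ∪ C ∪ D) :
    (A \ F).card ≤ (B \ F).card + (C \ F).card + D.card := by
  have : A \ F ⊆ (B \ F ∪ C \ F) ∪ D := by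
    intro x hx
    have := h (Finset.mem_sdiff.1 hx).1
    simp only [Finset.mem_union, Finset.mem_sdiff] at *
    tauto
  refine (Finset.card_le_card this).trans ((Finset.card_union_le _ _).trans ?_)
  have := Finset.card_union_le (B \ F) (C \ F)
  omega

theorem card_factors_seq_sdiff_le (env : List Str) {k : ℕ} (hk : 0 < k) (xs : List GSym) :
    (factors (xs.flatMap (GSym.eval env)) k \ envFactors env k).card ≤ xs.length * k := by
  induction xs with
  | nil => simp [factors_nil hk]
  | cons x xs ih =>
    rw [List.flatMap_cons]
    refine (card_sdiff_le_add_add (factors_append_subset (List.prefix_refl _) k)).trans ?_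
    have h1 := card_factors_sym_sdiff_le env hk x
    have h2 := card_crossing_le (x.eval env) (xs.flatMap (GSym.eval env)) k
    rw [List.length_cons, Nat.succ_mul]
    omega

theorem flatten_replicate_prefix (v : Str) {s t : ℕ} (h : s ≤ t) :
    (List.replicate s v).flatten <+: (List.replicate t v).flatten := by
  obtain ⟨d, rfl⟩ := Nat.exists_eq_add_of_le h
  rw [List.replicate_add, List.flatten_append]
  exact List.prefix_append _ _

/-- Peeling off one copy of `v` at a time, the windows that cross the first boundary of any shorter
power already cross the one of `v · v^t`. The bound is thus independent of the exponent. -/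
theorem factors_run_subset (v : Str) {k : ℕ} (hk : 0 < k) {s t : ℕ} (h : s ≤ t) :
    factors (List.replicate s v).flatten k ⊆
      factors v k ∪ crossing v (List.replicate t v).flatten k := by
  induction s with
  | zero => simp [factors_nil hk]
  | succ s ih =>
    rw [List.replicate_succ, List.flatten_cons]
    refine (factors_append_subset (flatten_replicate_prefix v (by omega : s ≤ t)) k).trans ?_
    intro u hu
    have := @ih (by omega) u
    simp only [Finset.mem_union] at *
    tauto

/-- Only windows that cross a boundary between symbols, and single terminals, can be new. Each
symbol of a sequence accounts for at most `1 + (k - 1)` of them, and so does a whole run; a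
truncation creates no crossing windows. -/
theorem card_factors_rule_sdiff_le (env : List Str) {k : ℕ} (hk : 0 < k) (r : GRule) :
    (factors (r.eval env) k \ envFactors env k).card ≤ r.size * k := by
  cases r with
  | seq xs => exact card_factors_seq_sdiff_le env hk xs
  | run x t =>
    have h0 : factors (GRule.eval env (.run x t)) k ⊆ factors (x.eval env) k ∪ ∅ ∪
        crossing (x.eval env) (List.replicate t (x.eval env)).flatten k := by
      rw [Finset.union_empty]
      exact factors_run_subset (x.eval env) hk (le_refl t)
    refine (card_sdiff_le_add_add h0).trans ?_
    have h1 := card_factors_sym_sdiff_le env hk x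
    have h2 := card_crossing_le (x.eval env) (List.replicate t (x.eval env)).flatten k
    simp only [GRule.size, Finset.empty_sdiff, Finset.card_empty]
    omega
  | truncL x t =>
    have h0 : factors (GRule.eval env (.truncL x t)) k ⊆ factors (x.eval env) k :=
      factors_mono (List.take_prefix _ _).isInfix k
    refine (Finset.card_le_card (Finset.sdiff_subset_sdiff h0 le_rfl)).trans ?_
    have h1 := card_factors_sym_sdiff_le env hk x
    simp only [GRule.size]
    omega
  | truncR x t =>
    have h0 : factors (GRule.eval env (.truncR x t)) k ⊆ factors (x.eval env) k :=
      factors_mono (List.drop_suffix _ _).isInfix k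
    refine (Finset.card_le_card (Finset.sdiff_subset_sdiff h0 le_rfl)).trans ?_
    have h1 := card_factors_sym_sdiff_le env hk x
    simp only [GRule.size]
    omega

theorem values_append_singleton (p : Prog) (r : GRule) :
    Prog.values (p ++ [r]) = Prog.values p ++ [r.eval (Prog.values p)] := by
  simp [Prog.values, List.foldl_append]

theorem card_envFactors_values_le (p : Prog) {k : ℕ} (hk : 0 < k) :
    (envFactors p.values k).card ≤ p.size * k := by
  induction p using List.reverseRecOn with
  | nil => simp [Prog.values, envFactors]
  | append_singleton p r ih =>
    have hsub : envFactors (Prog.values (p ++ [r])) k ⊆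
        envFactors (Prog.values p) k ∪
          (factors (r.eval (Prog.values p)) k \ envFactors (Prog.values p) k) := by
      intro u hu
      rw [values_append_singleton] at hu
      simp only [Finset.mem_union, Finset.mem_sdiff, mem_envFactors, List.mem_append,
        List.mem_singleton] at *
      obtain ⟨v, hv | rfl, hu⟩ := hu
      · exact Or.inl ⟨v, hv, hu⟩
      · tauto
    refine (Finset.card_le_card hsub).trans ((Finset.card_union_le _ _).trans ?_)
    have h2 := card_factors_rule_sdiff_le (Prog.values p) hk r
    have h3 : Prog.size (p ++ [r]) = Prog.size p + r.size := by simp [Prog.size]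
    rw [h3, add_mul]
    omega

theorem Prog.Generates.delta_le {p : Prog} {w : Str} (h : p.Generates w) : delta w ≤ p.size := by
  refine Repet.delta_le fun k hk _ => le_trans (Finset.card_le_card ?_)
    (card_envFactors_values_le p hk)
  intro u hu
  exact mem_envFactors.2 ⟨w, List.mem_of_getLast? h.2, hu⟩

theorem generates_literal (w : Str) : Prog.Generates [.seq (w.map .term)] w := by
  constructor
  · intro i r hr j hj
    rcases i with _ | i
    · simp at hr; subst hr; simp [GRule.syms] at hj
    · simp at hr
  · simp [Prog.values, GRule.eval, List.flatMap_map, GSym.eval]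

theorem delta_le_collage {w : Str} (hw : w ≠ []) : delta w ≤ collage w := by
  obtain ⟨p, -, hp, hs⟩ := Nat.sInf_mem (s := {k | ∃ p : Prog,
    (∀ r ∈ p, r.IsPlain ∨ r.IsRun ∨ r.IsTrunc) ∧ p.Generates w ∧ p.size = k})
    ⟨_, [.seq (w.map .term)], by simpa [GRule.IsPlain, GRule.IsRun, GRule.IsTrunc] using hw, generates_literal w, rfl⟩
  have := hp.delta_le
  rwa [hs] at this

theorem collage_le_rlslp {w : Str} (hw : w ≠ []) : collage w ≤ rlslp w := by
  obtain ⟨p, h1, hp, hs⟩ := Nat.sInf_mem (s := {k | ∃ p : Prog,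
    (∀ r ∈ p, r.IsPlain ∨ r.IsRun) ∧ p.Generates w ∧ p.size = k})
    ⟨_, [.seq (w.map .term)], by simpa [GRule.IsPlain, GRule.IsRun, GRule.IsTrunc] using hw, generates_literal w, rfl⟩
  exact Nat.sInf_le ⟨p, fun r hr => (h1 r hr).imp_right Or.inl, hp, hs⟩

/-! ### Runs in the Burrows-Wheeler transform -/

/-- The number of maximal runs of equal symbols. -/
def numRuns {α : Type*} [DecidableEq α] (l : List α) : ℕ := (l.destutter (· ≠ ·)).length

theorem numRuns_singleton {α : Type*} [DecidableEq α] (a : α) : numRuns [a] = 1 := by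
  simp [numRuns]

theorem numRuns_cons_cons {α : Type*} [DecidableEq α] (a b : α) (l : List α) :
    numRuns (a :: b :: l) = numRuns (b :: l) + if a = b then 0 else 1 := by
  unfold numRuns
  rw [List.destutter_cons_cons]
  by_cases h : a = b
  · subst h; simp [List.destutter_cons']
  · simp [h, List.destutter_cons']

/-- If `v` is sorted along the list, the pair `(u, v)` takes at most as many values as `v` has
values and `u` has changes. -/
theorem card_image_pair_add_one_le {ι α β : Type*} [DecidableEq ι] [DecidableEq α] [LinearOrder β]
    (u : ι → α) (v : ι → β) (l : List ι) (hl : l ≠ []) (hs : l.Pairwise fun i j => v i ≤ v j) :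
    (l.toFinset.image fun i => (u i, v i)).card + 1 ≤
      (l.toFinset.image v).card + numRuns (l.map u) := by
  induction l with
  | nil => exact absurd rfl hl
  | cons i l ih =>
    cases l with
    | nil => simp [numRuns_singleton]
    | cons j l =>
      have ih := ih (by simp) (List.pairwise_cons.1 hs).2
      rw [List.toFinset_cons, Finset.image_insert, Finset.image_insert, List.map_cons,
        List.map_cons, numRuns_cons_cons]
      rw [List.map_cons] at ih
      by_cases hu : u i = u j
      · by_cases hv : v i = v j
        · rw [Finset.insert_eq_of_mem (Finset.mem_image.2 ⟨j, by simp, by simp [hu, hv]⟩),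
            Finset.insert_eq_of_mem (Finset.mem_image.2 ⟨j, by simp, by simp [hv]⟩)]
          omega
        · rw [Finset.card_insert_of_notMem (s := ((j :: l).toFinset.image v))]
          · have := Finset.card_insert_le (u i, v i) ((j :: l).toFinset.image fun i => (u i, v i))
            omega
          · intro h
            obtain ⟨t, ht, hvt⟩ := Finset.mem_image.1 h
            rw [List.mem_toFinset] at ht
            have h1 := (List.pairwise_cons.1 hs).1 j (by simp)
            have h2 : v j ≤ v t := by
              rcases List.mem_cons.1 ht with rfl | ht
              · exact le_rfl
              · exact (List.pairwise_cons.1 (List.pairwise_cons.1 hs).2).1 t ht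
            exact hv (le_antisymm h1 (hvt ▸ h2))
      · rw [if_neg hu]
        have h1 := Finset.card_insert_le (u i, v i) ((j :: l).toFinset.image fun i => (u i, v i))
        have h2 := Finset.card_le_card
          (Finset.subset_insert (v i) ((j :: l).toFinset.image v))
        omega

theorem take_le_take_of_le (k : ℕ) {s t : Str} (h : s ≤ t) : s.take k ≤ t.take k := by
  induction k generalizing s t with
  | zero => simp
  | succ k ih =>
    rcases h.eq_or_lt with rfl | h
    · exact le_rfl
    cases s with
    | nil =>
      cases t with
      | nil => exact le_rfl
      | cons b t => exact le_of_lt (List.Lex.nil : List.Lex (· < ·) [] (b :: t.take k))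
    | cons a s =>
      cases t with
      | nil => exact absurd h (List.not_lt_nil _)
      | cons b t =>
        rw [List.take_succ_cons, List.take_succ_cons]
        rcases List.cons_lt_cons_iff.1 h with h | ⟨rfl, hst⟩
        · exact le_of_lt (List.cons_lt_cons_iff.2 (Or.inl h))
        · rcases (ih (le_of_lt hst)).eq_or_lt with h' | h'
          · rw [h']
          · exact le_of_lt (List.cons_lt_cons_iff.2 (Or.inr ⟨rfl, h'⟩))

/-- The rotations of `w`, sorted lexicographically. -/
def sortedRotations (w : Str) : List Str :=
  ((List.range w.length).map fun i => w.rotate i).insertionSort (· ≤ ·)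

theorem mem_sortedRotations {w u : Str} :
    u ∈ sortedRotations w ↔ ∃ i < w.length, w.rotate i = u := by
  simp [sortedRotations]

theorem length_of_mem_sortedRotations {w u : Str} (h : u ∈ sortedRotations w) :
    u.length = w.length := by
  obtain ⟨i, -, rfl⟩ := mem_sortedRotations.1 h
  simp

theorem rotate_mem_sortedRotations {w : Str} (hw : w ≠ []) (i : ℕ) :
    w.rotate i ∈ sortedRotations w :=
  mem_sortedRotations.2 ⟨i % w.length, Nat.mod_lt _ (List.length_pos_iff.2 hw),
    List.rotate_mod w i⟩

theorem bwt_eq_map {w : Str} : bwt w = (sortedRotations w).map fun u => u.getLastD 0 := by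
  have : bwt w = (sortedRotations w).filterMap List.getLast? := rfl
  rw [this, ← List.filterMap_eq_map (f := fun u : Str => u.getLastD 0)]
  apply List.filterMap_congr
  intro u hu
  have hl := length_of_mem_sortedRotations hu
  obtain ⟨i, hi, -⟩ := mem_sortedRotations.1 hu
  have : u ≠ [] := by rintro rfl; simp at hl; omega
  simp [List.getLast?_eq_getLast_of_ne_nil this, List.getLastD_eq_getLast?]

/-- The factors of length `k` of the circular string `w`. -/
def circularFactors (w : Str) (k : ℕ) : Finset Str :=
  (sortedRotations w).toFinset.image (List.take k)

theorem factors_subset_circularFactors {w : Str} (hw : w ≠ []) (k : ℕ) :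
    factors w k ⊆ circularFactors w k := by
  intro u hu
  obtain ⟨i, hi, rfl⟩ := mem_factors_iff_exists.1 hu
  refine Finset.mem_image.2 ⟨w.rotate i, ?_, ?_⟩
  · exact List.mem_toFinset.2 (rotate_mem_sortedRotations hw i)
  · rw [List.rotate_eq_drop_append_take (by omega), List.take_append_of_le_length (by simp; omega)]

/-- A circular factor `c · s` of length `k + 1` is the last symbol `c` of a rotation followed by its
prefix `s`. Down the sorted list the prefix changes one time less than it has values, and the last
symbol changes `r - 1` times. Every new pair `(c, s)` needs one of these changes. -/
theorem card_circularFactors_succ_le {w : Str} (hw : w ≠ []) {k : ℕ} (hk : k < w.length) :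
    (circularFactors w (k + 1)).card + 1 ≤ (circularFactors w k).card + bwtRuns w := by
  have hne : sortedRotations w ≠ [] := by
    intro h
    have := rotate_mem_sortedRotations hw 0
    simp [h] at this
  have hsort : (sortedRotations w).Pairwise fun s t => s.take k ≤ t.take k :=
    (List.pairwise_insertionSort (· ≤ ·) _).imp fun h => take_le_take_of_le k h
  have hmain := card_image_pair_add_one_le (fun u : Str => u.getLastD 0) (List.take k)
    (sortedRotations w) hne hsort
  have hr : numRuns ((sortedRotations w).map fun u : Str => u.getLastD 0) = bwtRuns w := by
    rw [← bwt_eq_map]; rfl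
  rw [hr] at hmain
  have hmain' : ((sortedRotations w).toFinset.image fun u => (u.getLastD 0, u.take k)).card + 1 ≤
      (circularFactors w k).card + bwtRuns w := by
    unfold circularFactors
    convert hmain
  refine le_trans (Nat.add_le_add_right ?_ 1) hmain'
  have hsub : circularFactors w (k + 1) ⊆ (((sortedRotations w).toFinset.image
      fun u => (u.getLastD 0, u.take k)).image fun x => x.1 :: x.2) := by
    intro u hu
    obtain ⟨v, hv, rfl⟩ := Finset.mem_image.1 hu
    rw [List.mem_toFinset] at hv
    obtain ⟨i, hi, rfl⟩ := mem_sortedRotations.1 hv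
    obtain ⟨c, s, hcs⟩ : ∃ c s, w.rotate i = c :: s := by
      cases h : w.rotate i with
      | nil => simp at h; exact absurd h hw
      | cons c s => exact ⟨c, s, rfl⟩
    have hrot : w.rotate (i + 1) = s ++ [c] := by
      rw [← List.rotate_rotate, hcs]; simp
    have hlen : s.length + 1 = w.length := by
      rw [← List.length_rotate w i, hcs]; simp
    refine Finset.mem_image.2 ⟨(c, s.take k), Finset.mem_image.2 ⟨w.rotate (i + 1), ?_, ?_⟩, ?_⟩
    · exact List.mem_toFinset.2 (rotate_mem_sortedRotations hw _)
    · rw [hrot, List.take_append_of_le_length (by omega)]; simp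
    · rw [hcs]; simp
  exact (Finset.card_le_card hsub).trans Finset.card_image_le

theorem delta_le_bwtRuns {w : Str} (hw : w ≠ []) : delta w ≤ bwtRuns w := by
  have hn := List.length_pos_iff.2 hw
  have h0 : (circularFactors w 0).card ≤ 1 := by
    refine Finset.card_le_one.2 fun a ha b hb => ?_
    simp only [circularFactors, Finset.mem_image] at ha hb
    obtain ⟨_, _, rfl⟩ := ha
    obtain ⟨_, _, rfl⟩ := hb
    simp
  have key : ∀ k ≤ w.length, (circularFactors w k).card + k ≤ bwtRuns w * k + 1 := by
    intro k
    induction k with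
    | zero => intro _; omega
    | succ k ih =>
      intro hk
      have h1 := ih (by omega)
      have h2 := card_circularFactors_succ_le hw (k := k) (by omega)
      rw [Nat.mul_succ]
      omega
  refine delta_le fun k hk hkn => ?_
  have h1 := Finset.card_le_card (factors_subset_circularFactors hw k)
  have h2 := key k hkn
  omega

/-! ### From straight-line programs to L-systems, and from these to NU-systems -/

theorem morphPow_zero (φ : ℕ → Str) (s : Str) : morphPow φ 0 s = s := rfl

theorem morphPow_succ (φ : ℕ → Str) (d : ℕ) (s : Str) :
    morphPow φ (d + 1) s = morphPow φ d (s.flatMap φ) := rfl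

theorem morphPow_append (φ : ℕ → Str) (d : ℕ) (s t : Str) :
    morphPow φ d (s ++ t) = morphPow φ d s ++ morphPow φ d t := by
  induction d generalizing s t with
  | zero => rfl
  | succ d ih => simp only [morphPow_succ, List.flatMap_append, ih]

theorem morphPow_nil (φ : ℕ → Str) (d : ℕ) : morphPow φ d [] = [] := by
  induction d with
  | zero => rfl
  | succ d ih => simpa [morphPow_succ] using ih

theorem morphPow_eq_flatMap (φ : ℕ → Str) (d : ℕ) (s : Str) :
    morphPow φ d s = s.flatMap fun a => morphPow φ d [a] := by
  induction s with
  | nil => simp [morphPow_nil]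
  | cons a s ih => rw [List.flatMap_cons, ← ih, ← morphPow_append]; rfl

theorem length_values (p : Prog) : p.values.length = p.length := by
  induction p using List.reverseRecOn with
  | nil => simp [Prog.values]
  | append_singleton p r ih => simp [values_append_singleton, ih]

/-- The symbol of an L-system for a grammar symbol: terminals stand for themselves, and variables
come after all terminals. -/
def GSym.code (B : ℕ) : GSym → ℕ
  | .term a => a
  | .var i => B + i

/-- The rules of the L-system of a grammar with terminals below `B`. -/
def Prog.morph (p : Prog) (B a : ℕ) : Str :=
  if a < B then [a] else ((p[a - B]?).elim [a] fun r => r.syms.map (GSym.code B))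

theorem morphPow_morph_terminal (p : Prog) {B a : ℕ} (ha : a < B) (d : ℕ) :
    morphPow (p.morph B) d [a] = [a] := by
  induction d with
  | zero => rfl
  | succ d ih => rw [morphPow_succ]; simpa [Prog.morph, ha] using ih

theorem Acyclic.of_append {p : Prog} {r : GRule} (h : Prog.Acyclic (p ++ [r])) :
    Prog.Acyclic p ∧ ∀ j, GSym.var j ∈ r.syms → j < p.length := by
  refine ⟨fun i r' hr j hj => h i r' ?_ j hj, fun j hj => h p.length r (by simp) j hj⟩
  rw [List.getElem?_append_left (List.getElem?_eq_some_iff.1 hr).1]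
  exact hr

/-- One round replaces a variable by earlier variables and by terminals, which stay fixed, so after
`p.length` rounds the expansion is complete and stable. The morphism is that of a longer program
`P`, so that it does not change when the induction removes the last rule of `p`. -/
theorem morphPow_morph_variable {p : Prog} {B : ℕ} (hplain : ∀ r ∈ p, r.IsPlain)
    (hac : p.Acyclic) (hB : ∀ r ∈ p, ∀ a, GSym.term a ∈ r.syms → a < B) (P : Prog)
    (hP : p <+: P) {i d : ℕ} (hi : i < p.length) (hd : p.length ≤ d) :
    morphPow (P.morph B) d [B + i] = p.values.getD i [] := by
  induction p using List.reverseRecOn generalizing i d with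
  | nil => simp at hi
  | append_singleton p r ih =>
    obtain ⟨hac', hr⟩ := Acyclic.of_append hac
    have ih := fun {i d} => @ih (fun r h => hplain r (by simp [h])) hac'
      (fun r h => hB r (by simp [h])) ((List.prefix_append p [r]).trans hP) i d
    rw [List.length_append, List.length_singleton] at hi hd
    rw [values_append_singleton]
    by_cases hip : i < p.length
    · rw [ih hip (by omega), List.getD_append _ _ _ _ (by rwa [length_values])]
    · obtain rfl : i = p.length := by omega
      obtain ⟨d, rfl⟩ : ∃ e, d = e + 1 := ⟨d - 1, by omega⟩
      obtain ⟨t, rfl⟩ := hP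
      rw [morphPow_succ]
      have hrule : Prog.morph (p ++ [r] ++ t) B (B + p.length) = r.syms.map (GSym.code B) := by
        simp [Prog.morph]
      have hval : (Prog.values p ++ [r.eval (Prog.values p)]).getD p.length [] =
          r.eval (Prog.values p) := by
        rw [← length_values p]; simp [List.getD]
      rw [List.flatMap_singleton, hrule, hval]
      have hp := hplain r (by simp)
      have hB' := hB r (by simp)
      cases r with
      | seq xs =>
        simp only [GRule.syms, GRule.eval] at *
        rw [morphPow_eq_flatMap, List.flatMap_map]
        apply List.flatMap_congr
        intro x hx
        cases x with
        | term a => exact morphPow_morph_terminal _ (hB' a hx) d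
        | var j => exact ih (hr j hx) (by omega)
      | run x k => exact hp.elim
      | truncL x k => exact hp.elim
      | truncR x k => exact hp.elim

/-- The terminals of a right-hand side. -/
def GRule.terminals (r : GRule) : List ℕ :=
  r.syms.filterMap fun | .term a => some a | .var _ => none

theorem GRule.mem_terminals {r : GRule} {a : ℕ} : a ∈ r.terminals ↔ GSym.term a ∈ r.syms := by
  simp only [GRule.terminals, List.mem_filterMap]
  constructor
  · rintro ⟨x, hx, h⟩
    cases x with
    | term b => simp at h; rwa [← h]
    | var i => simp at h
  · intro h; exact ⟨_, h, rfl⟩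

theorem length_terminals_le (p : Prog) (hplain : ∀ r ∈ p, r.IsPlain) :
    (p.flatMap GRule.terminals).length ≤ p.size := by
  induction p with
  | nil => simp
  | cons r p ih =>
    have := ih fun r h => hplain r (by simp [h])
    have h1 : r.terminals.length ≤ r.size := by
      have hr := hplain r (by simp)
      cases r with
      | seq xs => exact List.length_filterMap_le _ _
      | run x k => exact hr.elim
      | truncL x k => exact hr.elim
      | truncR x k => exact hr.elim
    simp only [List.flatMap_cons, List.length_append, Prog.size, List.map_cons,
      List.sum_cons] at *
    omega

theorem length_le_size (p : Prog) (hplain : ∀ r ∈ p, r.IsPlain) : p.length ≤ p.size := by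
  induction p with
  | nil => simp
  | cons r p ih =>
    have := ih fun r h => hplain r (by simp [h])
    have h1 : 1 ≤ r.size := by
      have hr := hplain r (by simp)
      cases r with
      | seq xs => exact List.length_pos_iff.2 hr
      | run x k => exact hr.elim
      | truncL x k => exact hr.elim
      | truncR x k => exact hr.elim
    simp only [Prog.size, List.map_cons, List.sum_cons, List.length_cons] at *
    omega

theorem sum_length_morph (p : Prog) (hplain : ∀ r ∈ p, r.IsPlain) (B : ℕ) :
    ∑ i ∈ Finset.range p.length, (p.morph B (B + i)).length = p.size := by
  induction p using List.reverseRecOn with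
  | nil => simp [Prog.size]
  | append_singleton p r ih =>
    rw [List.length_append, List.length_singleton, Finset.sum_range_succ]
    have h1 := ih fun r h => hplain r (by simp [h])
    have h2 : ∑ i ∈ Finset.range p.length, (Prog.morph (p ++ [r]) B (B + i)).length =
        ∑ i ∈ Finset.range p.length, (Prog.morph p B (B + i)).length := by
      refine Finset.sum_congr rfl fun i hi => ?_
      rw [Finset.mem_range] at hi
      simp [Prog.morph, List.getElem?_append_left hi]
    have h3 : (Prog.morph (p ++ [r]) B (B + p.length)).length = r.size := by
      have hr := hplain r (by simp)
      cases r with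
      | seq xs => simp [Prog.morph, GRule.syms, GRule.size]
      | run x k => exact hr.elim
      | truncL x k => exact hr.elim
      | truncR x k => exact hr.elim
    have h4 : Prog.size (p ++ [r]) = Prog.size p + r.size := by simp [Prog.size]
    rw [h2, h1, h3, h4]

theorem exists_lSystem_of_slp {p : Prog} {w : Str} (hplain : ∀ r ∈ p, r.IsPlain)
    (hp : p.Generates w) : ∃ L : LSystem, L.Valid ∧ L.depth = p.length ∧ L.len = w.length ∧
      L.Generates w ∧ L.size ≤ 7 * p.size := by
  obtain ⟨hac, hlast⟩ := hp
  set T := (p.flatMap GRule.terminals).toFinset with hT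
  have hmemT : ∀ a, a ∈ T ↔ ∃ r ∈ p, GSym.term a ∈ r.syms := by
    intro a; simp [hT, GRule.mem_terminals]
  set B := T.sup id + 1 with hB
  have hTB : ∀ a ∈ T, a < B := fun a ha => Nat.lt_succ_of_le (Finset.le_sup (f := id) ha)
  have hpos : 0 < p.length := by
    rw [← length_values]
    apply List.length_pos_iff.2
    intro h; rw [h] at hlast; simp at hlast
  have hval : p.values.getD (p.length - 1) [] = w := by
    rw [List.getLast?_eq_getElem?, length_values] at hlast
    simp [List.getD, hlast]
  have hexp : morphPow (p.morph B) p.length [B + (p.length - 1)] = w := by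
    rw [morphPow_morph_variable hplain hac (fun r hr a ha => hTB a ((hmemT a).2 ⟨r, hr, ha⟩)) p
      (List.prefix_refl p) (by omega) le_rfl, hval]
  set V := (Finset.range p.length).image (B + ·) with hV
  have hdisj : Disjoint T V := by
    rw [Finset.disjoint_left]
    intro a ha hav
    obtain ⟨i, -, rfl⟩ := Finset.mem_image.1 hav
    have := hTB _ ha
    omega
  have hrule : ∀ i < p.length, ∃ r ∈ p, p[i]? = some r ∧
      p.morph B (B + i) = r.syms.map (GSym.code B) := by
    intro i hi
    exact ⟨p[i], List.getElem_mem hi, by simp, by simp [Prog.morph, hi]⟩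
  have hTcard : T.card ≤ p.size :=
    (List.toFinset_card_le _).trans (length_terminals_le p hplain)
  have hVcard : V.card = p.length := by
    rw [hV, Finset.card_image_of_injective _ (add_right_injective B), Finset.card_range]
  refine ⟨⟨T ∪ V, p.morph B, id, [B + (p.length - 1)], p.length, w.length⟩, ⟨?_, ?_, ?_, ?_⟩,
    rfl, rfl, ⟨?_, ?_⟩, ?_⟩
  · intro a ha
    rcases Finset.mem_union.1 ha with ha | ha
    · have : p.morph B a = [a] := by simp [Prog.morph, hTB a ha]
      simp only [this]
      exact ⟨by simp, by simp [ha]⟩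
    · obtain ⟨i, hi, rfl⟩ := Finset.mem_image.1 ha
      obtain ⟨r, hr, hir, heq⟩ := hrule i (Finset.mem_range.1 hi)
      simp only [heq]
      constructor
      · have := hplain r hr
        cases r with
        | seq xs => simpa [GRule.syms, GRule.IsPlain] using this
        | run x k => exact this.elim
        | truncL x k => exact this.elim
        | truncR x k => exact this.elim
      · intro b hb
        obtain ⟨x, hx, rfl⟩ := List.mem_map.1 hb
        cases x with
        | term a => exact Finset.mem_union_left _ ((hmemT a).2 ⟨r, hr, hx⟩)
        | var j =>
          have := hac i r hir j hx
          rw [Finset.mem_range] at hi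
          exact Finset.mem_union_right _ (Finset.mem_image.2
            ⟨j, Finset.mem_range.2 (by omega), rfl⟩)
  · exact fun a ha => ha
  · simp
  · intro a ha
    rw [List.mem_singleton] at ha
    subst ha
    exact Finset.mem_union_right _ (Finset.mem_image.2
      ⟨p.length - 1, Finset.mem_range.2 (by omega), rfl⟩)
  · simp only [hexp, le_refl]
  · simp only [hexp, List.map_id, List.take_length]
  -- The size is `2|T| + p.size + p.length + 3`. Since `|T|` and `p.length` are at most `p.size`,
  -- and `p.size` is at least `1`, this is at most `7 * p.size`.
  · simp only [LSystem.size]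
    rw [Finset.sum_union hdisj, Finset.card_union_of_disjoint hdisj, hVcard, hV,
      Finset.sum_image fun _ _ _ _ h => add_left_cancel h, sum_length_morph p hplain]
    have h1 : ∑ a ∈ T, (p.morph B a).length = T.card := by
      rw [Finset.card_eq_sum_ones]
      refine Finset.sum_congr rfl fun a ha => ?_
      simp [Prog.morph, hTB a ha]
    rw [h1, List.length_singleton]
    have := length_le_size p hplain
    omega

theorem exists_slp {w : Str} (hw : w ≠ []) :
    ∃ p : Prog, (∀ r ∈ p, r.IsPlain) ∧ p.Generates w ∧ p.size = slp w :=
  Nat.sInf_mem (s := {k | ∃ p : Prog, (∀ r ∈ p, r.IsPlain) ∧ p.Generates w ∧ p.size = k})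
    ⟨_, [.seq (w.map .term)], by simpa [GRule.IsPlain] using hw, generates_literal w, rfl⟩

theorem slp_le_length {w : Str} (hw : w ≠ []) : slp w ≤ w.length :=
  Nat.sInf_le ⟨[.seq (w.map .term)], by simpa [GRule.IsPlain] using hw, generates_literal w,
    by simp [Prog.size, GRule.size]⟩

/-- The depth is the number of variables of a smallest program. Comparison with the one-rule program
that spells out `w` bounds it by `|w|`, hence by `|w|^K`. -/
theorem exists_lSystem_le_slp {K : ℕ} (hK : 1 ≤ K) {w : Str} (hw : w ≠ []) :
    ∃ L : LSystem, L.Valid ∧ L.depth ≤ L.len ^ K ∧ L.Generates w ∧ L.size ≤ 7 * slp w := by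
  obtain ⟨p, h1, h2, h3⟩ := exists_slp hw
  obtain ⟨L, hL, hd, hn, hg, hs⟩ := exists_lSystem_of_slp h1 h2
  refine ⟨L, hL, ?_, hg, h3 ▸ hs⟩
  rw [hd, hn]
  calc p.length ≤ p.size := length_le_size p h1
    _ ≤ w.length := h3 ▸ slp_le_length hw
    _ ≤ w.length ^ K := Nat.le_self_pow (by omega) _

theorem ell_le {K : ℕ} {w : Str} {L : LSystem} (hL : L.Valid) (hd : L.depth ≤ L.len ^ K)
    (hg : L.Generates w) : ell K w ≤ L.size :=
  Nat.sInf_le ⟨L, hL, hd, hg, rfl⟩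

theorem exists_lSystem_eq_ell {K : ℕ} (hK : 1 ≤ K) {w : Str} (hw : w ≠ []) :
    ∃ L : LSystem, L.Valid ∧ L.depth ≤ L.len ^ K ∧ L.Generates w ∧ L.size = ell K w := by
  obtain ⟨L, h1, h2, h3, -⟩ := exists_lSystem_le_slp hK hw
  exact Nat.sInf_mem (s := {m | ∃ L : LSystem, L.Valid ∧ L.depth ≤ L.len ^ K ∧ L.Generates w ∧
    L.size = m}) ⟨_, L, h1, h2, h3, rfl⟩

theorem ell_le_slp {K : ℕ} (hK : 1 ≤ K) {w : Str} (hw : w ≠ []) : ell K w ≤ 7 * slp w := by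
  obtain ⟨L, h1, h2, h3, h4⟩ := exists_lSystem_le_slp hK hw
  exact (ell_le h1 h2 h3).trans h4

/-- An L-system as a NU-system without extractions. -/
def LSystem.toNUSystem (L : LSystem) : NUSystem :=
  ⟨L.alph, fun a => (L.rule a).map .var, L.code, L.start, L.depth, L.len⟩

theorem LSystem.Valid.toNUSystem {L : LSystem} (h : L.Valid) : L.toNUSystem.Valid := by
  obtain ⟨h1, h2, h3, h4⟩ := h
  refine ⟨fun a ha => ⟨by simpa [LSystem.toNUSystem] using (h1 a ha).1, fun x hx => ?_⟩, h2, h3, h4⟩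
  obtain ⟨b, hb, rfl⟩ := List.mem_map.1 hx
  exact (h1 a ha).2 b hb

/-- With no extractions to resolve, the first round already yields the complete rules. -/
theorem LSystem.resolves_toNUSystem (L : LSystem) : L.toNUSystem.Resolves L.rule := by
  refine ⟨1, fun a _ => ?_⟩
  simp only [NUSystem.approx, LSystem.toNUSystem]
  rw [List.flatMap_map, List.map_eq_flatMap]
  rfl

theorem LSystem.size_toNUSystem (L : LSystem) : L.toNUSystem.size = L.size := by
  simp [NUSystem.size, LSystem.size, LSystem.toNUSystem, Function.comp_def, NUSym.weight]

theorem nu_le_ell {K : ℕ} (hK : 1 ≤ K) {w : Str} (hw : w ≠ []) : nu K w ≤ ell K w := by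
  obtain ⟨L, h1, h2, h3, h4⟩ := exists_lSystem_eq_ell hK hw
  exact Nat.sInf_le ⟨L.toNUSystem, h1.toNUSystem, h2, ⟨L.rule, L.resolves_toNUSystem, h3⟩,
    L.size_toNUSystem.trans h4⟩

/-! ### A constant-size L-system generating strings of unbounded substring complexity -/

/-- The morphism `0 → 01, 1 → 12, 2 → 2`. -/
def quadRule : ℕ → Str
  | 0 => [0, 1]
  | 1 => [1, 2]
  | _ => [2]

/-- The `d`-th level `0 · 1 · 12 · 122 ⋯ 12^{d-1}` of the morphism. -/
def quadStr (d : ℕ) : Str := morphPow quadRule d [0]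

theorem morphPow_quadRule_two (d k : ℕ) :
    morphPow quadRule d (List.replicate k 2) = List.replicate k 2 := by
  induction d with
  | zero => rfl
  | succ d ih =>
    rw [morphPow_succ]
    have : (List.replicate k 2).flatMap quadRule = List.replicate k 2 := by
      clear ih
      induction k with
      | zero => rfl
      | succ k ihk => rw [List.replicate_succ, List.flatMap_cons, ihk]; rfl
    rw [this, ih]

theorem morphPow_quadRule_one (d : ℕ) :
    morphPow quadRule d [1] = 1 :: List.replicate d 2 := by
  induction d with
  | zero => rfl
  | succ d ih =>
    have : morphPow quadRule (d + 1) [1] = morphPow quadRule d ([1] ++ List.replicate 1 2) := rfl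
    rw [this, morphPow_append, ih, morphPow_quadRule_two, List.cons_append,
      List.replicate_append_replicate]

theorem quadStr_succ (d : ℕ) : quadStr (d + 1) = quadStr d ++ 1 :: List.replicate d 2 := by
  have : quadStr (d + 1) = morphPow quadRule d ([0] ++ [1]) := rfl
  rw [this, morphPow_append, morphPow_quadRule_one]; rfl

theorem le_length_quadStr (d : ℕ) : d + 1 ≤ (quadStr d).length := by
  induction d with
  | zero => simp [quadStr, morphPow_zero]
  | succ d ih => rw [quadStr_succ]; simp; omega

theorem mem_quadStr (d : ℕ) : ∀ a ∈ quadStr d, a ∈ ({0, 1, 2} : Finset ℕ) := by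
  induction d with
  | zero => simp [quadStr, morphPow_zero]
  | succ d ih =>
    intro a ha
    rw [quadStr_succ, List.mem_append, List.mem_cons] at ha
    rcases ha with ha | rfl | ha
    · exact ih a ha
    · simp
    · rw [List.eq_of_mem_replicate ha]; simp

theorem ell_quadStr_le {K : ℕ} (hK : 1 ≤ K) (d : ℕ) : ell K (quadStr d) ≤ 11 := by
  refine (ell_le (L := ⟨{0, 1, 2}, quadRule, id, [0], d, (quadStr d).length⟩) ⟨?_, ?_, ?_, ?_⟩
    ?_ ⟨?_, ?_⟩).trans ?_
  · simp [quadRule]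
  · simp
  · simp
  · simp
  · have := le_length_quadStr d
    exact (by omega : d ≤ (quadStr d).length).trans (Nat.le_self_pow (by omega) _)
  · exact le_rfl
  · simp [quadStr]
  · simp [LSystem.size, quadRule]

theorem quadStr_prefix {d e : ℕ} (h : d ≤ e) : quadStr d <+: quadStr e := by
  induction e, h using Nat.le_induction with
  | base => exact List.prefix_refl _
  | succ e _ ih => rw [quadStr_succ]; exact ih.trans (List.prefix_append _ _)

/-- The level `i + 2` ends with the consecutive blocks `1 2^{i-1} · 1 2^i · 1 2^{i+1}`. -/
theorem block_infix_quadStr {x i y d : ℕ} (hx : x + 1 ≤ i) (hy : y ≤ i + 1) (hd : i + 2 ≤ d) :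
    List.replicate x 2 ++ 1 :: (List.replicate i 2 ++ 1 :: List.replicate y 2) <:+: quadStr d := by
  refine List.IsInfix.trans ?_ (quadStr_prefix hd).isInfix
  obtain ⟨i, rfl⟩ : ∃ e, i = e + 1 := ⟨i - 1, by omega⟩
  obtain ⟨u, rfl⟩ := Nat.exists_eq_add_of_le (by omega : x ≤ i)
  obtain ⟨v, hv⟩ := Nat.exists_eq_add_of_le hy
  refine ⟨quadStr (x + u) ++ 1 :: List.replicate u 2, List.replicate v 2, ?_⟩
  have h1 : List.replicate (x + u) 2 = List.replicate u 2 ++ List.replicate x 2 := by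
    rw [List.replicate_append_replicate, add_comm]
  rw [quadStr_succ, quadStr_succ, quadStr_succ, hv, List.replicate_add y v, h1]
  simp only [List.append_assoc, List.cons_append]

theorem block_injective {x i t x' i' t' : ℕ}
    (h : List.replicate x 2 ++ 1 :: (List.replicate i 2 ++ 1 :: List.replicate t 2) =
      List.replicate x' 2 ++ 1 :: (List.replicate i' 2 ++ 1 :: List.replicate t' 2)) :
    x = x' ∧ i = i' := by
  have key : ∀ (a b : ℕ) (s r : Str),
      List.replicate a 2 ++ 1 :: s = List.replicate b 2 ++ 1 :: r → a = b ∧ s = r := by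
    intro a
    induction a with
    | zero =>
      rintro (_ | b) s r h
      · simpa using h
      · simp [List.replicate_succ] at h
    | succ a ih =>
      rintro (_ | b) s r h
      · simp [List.replicate_succ] at h
      · have := ih b s r (by simpa [List.replicate_succ] using h)
        exact ⟨by omega, this.2⟩
  obtain ⟨h1, h2⟩ := key _ _ _ _ h
  exact ⟨h1, (key _ _ _ _ h2).1⟩

/-- The words `2^x 1 2^{2q+2+i} 1 2^{2q+2-i-x}` with `i, x ≤ q` all have length `4q + 6`. The middle
run identifies `i` and the first run identifies `x`, so they are pairwise distinct. -/
theorem sq_le_card_factors_quadStr (q : ℕ) :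
    (q + 1) * (q + 1) ≤ (factors (quadStr (4 * q + 6)) (4 * q + 6)).card := by
  have hinj : Set.InjOn (fun z : ℕ × ℕ => (List.replicate z.2 2 ++ 1 ::
      (List.replicate (2 * q + 2 + z.1) 2 ++ 1 :: List.replicate (2 * q + 2 - z.1 - z.2) 2) : Str))
      ((Finset.range (q + 1) ×ˢ Finset.range (q + 1) : Finset (ℕ × ℕ)) : Set (ℕ × ℕ)) := by
    rintro ⟨i, x⟩ - ⟨i', x'⟩ - h
    obtain ⟨h1, h2⟩ := block_injective h
    simp only [Prod.mk.injEq]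
    simp only at h1 h2
    omega
  have hcard := Finset.card_image_of_injOn hinj
  rw [Finset.card_product, Finset.card_range] at hcard
  rw [← hcard]
  apply Finset.card_le_card
  intro u hu
  obtain ⟨⟨i, x⟩, hz, rfl⟩ := Finset.mem_image.1 hu
  simp only [Finset.mem_product, Finset.mem_range] at hz
  rw [mem_factors]
  refine ⟨block_infix_quadStr (by omega) (by omega) (by omega), ?_⟩
  simp
  omega

theorem le_delta_quadStr (q : ℕ) : ((q : ℝ) + 1) / 6 ≤ delta (quadStr (4 * q + 6)) := by
  have h1 := div_le_delta (w := quadStr (4 * q + 6)) (k := 4 * q + 6) (by omega)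
    (by have := le_length_quadStr (4 * q + 6); omega)
  refine le_trans ?_ h1
  rw [div_le_div_iff₀ (by norm_num) (by positivity)]
  have h2 : (((q + 1) * (q + 1) : ℕ) : ℝ) ≤ (factors (quadStr (4 * q + 6)) (4 * q + 6)).card := by
    exact_mod_cast sq_le_card_factors_quadStr q
  push_cast at h2 ⊢
  nlinarith [(Nat.cast_nonneg q : (0 : ℝ) ≤ q)]

theorem smallerOnSomeFamily_of_delta_le {K : ℕ} (hK : 1 ≤ K) (μ : Str → ℝ)
    (hμ : ∀ w, w ≠ [] → delta w ≤ μ w) :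
    SmallerOnSomeFamily (fun w => (ell K w : ℝ)) μ := by
  have hle := fun q => le_length_quadStr (4 * q + 6)
  refine ⟨{0, 1, 2}, fun q => quadStr (4 * q + 6), fun q => mem_quadStr _, ?_, ?_⟩
  · refine tendsto_atTop_mono (fun q => ?_) tendsto_id
    have := hle q
    simp only [id]; omega
  · have hO : (fun q => (ell K (quadStr (4 * q + 6)) : ℝ)) =O[atTop] fun _ => (1 : ℝ) := by
      refine IsBigO.of_bound 11 (Eventually.of_forall fun q => ?_)
      have : (ell K (quadStr (4 * q + 6)) : ℝ) ≤ 11 := by exact_mod_cast ell_quadStr_le hK _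
      simpa using this
    refine hO.trans_isLittleO ?_
    rw [isLittleO_one_left_iff]
    have hμ' : ∀ q : ℕ, ((q : ℝ) + 1) / 6 ≤ ‖μ (quadStr (4 * q + 6))‖ := fun q =>
      (le_delta_quadStr q).trans ((hμ _ (by
        have := hle q
        intro h; rw [h] at this; simp at this)).trans (Real.le_norm_self _))
    refine tendsto_atTop_mono hμ' ?_
    exact (tendsto_atTop_add_const_right _ _ tendsto_natCast_atTop_atTop).atTop_div_const
      (by norm_num)

/-! ### Counting the binary strings generated by small L-systems -/

theorem map_morphPow {φ ψ : ℕ → Str} {A : Finset ℕ} {e : ℕ → ℕ}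
    (hA : ∀ a ∈ A, ∀ b ∈ φ a, b ∈ A) (h : ∀ a ∈ A, ψ (e a) = (φ a).map e) (d : ℕ) {s : Str}
    (hs : ∀ a ∈ s, a ∈ A) :
    (∀ a ∈ morphPow φ d s, a ∈ A) ∧ (morphPow φ d s).map e = morphPow ψ d (s.map e) := by
  induction d generalizing s with
  | zero => exact ⟨hs, rfl⟩
  | succ d ih =>
    have := @ih (s.flatMap φ) (by
      intro b hb
      obtain ⟨a, ha, hb⟩ := List.mem_flatMap.1 hb
      exact hA a (hs a ha) b hb)
    refine ⟨this.1, ?_⟩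
    rw [morphPow_succ, this.2, morphPow_succ, List.map_flatMap, List.flatMap_map]
    congr 1
    exact List.flatMap_congr fun a ha => (h a (hs a ha)).symm

/-- The string generated by the L-system with axiom `ls[0]`, coding `ls[1]` and rules
`ls[2], ls[3], …`, where all the symbols are shifted by one. -/
def decodeLSystem (ls : List (List ℕ)) (d n : ℕ) : Str :=
  ((morphPow (fun i => (ls.getD (i + 2) []).map Nat.pred) d ((ls.getD 0 []).map Nat.pred)).map
    fun i => (ls.getD 1 []).getD i 0 - 1).take n

/-- Letters are renamed to their indices in a list of the alphabet, which bounds them by the size.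
The coding only needs to tell which letters become `1`. The shift by one reserves `0` as a
separator, by which the lists can be concatenated into one word. -/
theorem LSystem.Valid.exists_decode {L : LSystem} (hL : L.Valid) {w : Str} (hg : L.Generates w)
    (hw : ∀ a ∈ w, a < 2) : ∃ ls : List (List ℕ), ls ≠ [] ∧
      (∀ l ∈ ls, ∀ x ∈ l, 0 < x ∧ x ≤ L.size) ∧ (ls.map List.length).sum + ls.length ≤ 2 * L.size ∧
      decodeLSystem ls L.depth L.len = w := by
  obtain ⟨h1, h2, h3, h4⟩ := hL
  set l := L.alph.toList with hl
  have hmem : ∀ a, a ∈ l ↔ a ∈ L.alph := fun a => Finset.mem_toList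
  have hlen : l.length = L.alph.card := Finset.length_toList _
  set e : ℕ → ℕ := fun a => l.idxOf a with he
  have he1 : ∀ a ∈ L.alph, e a < L.alph.card := fun a ha =>
    hlen ▸ List.idxOf_lt_length_of_mem ((hmem a).2 ha)
  have hget : ∀ {β : Type} (f : ℕ → β) (y : β), ∀ a ∈ L.alph, (l.map f).getD (e a) y = f a := by
    intro β f y a ha
    have := List.idxOf_lt_length_of_mem ((hmem a).2 ha)
    simp [List.getD, he, this]
  have hsize : L.alph.card + 2 ≤ L.size := by unfold LSystem.size; omega
  refine ⟨L.start.map (fun a => e a + 1) :: l.map (fun a => if L.code a = 1 then 2 else 1) ::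
    l.map fun a => (L.rule a).map fun a => e a + 1, by simp, ?_, ?_, ?_⟩
  · intro t ht x hx
    simp only [List.mem_cons, List.mem_map] at ht
    rcases ht with rfl | rfl | ⟨a, ha, rfl⟩
    · obtain ⟨b, hb, rfl⟩ := List.mem_map.1 hx
      have := he1 b (h4 b hb)
      omega
    · obtain ⟨b, hb, rfl⟩ := List.mem_map.1 hx
      split_ifs <;> omega
    · obtain ⟨b, hb, rfl⟩ := List.mem_map.1 hx
      have := he1 b ((h1 a ((hmem a).1 ha)).2 b hb)
      omega
  · have hsum : (l.map fun a => (L.rule a).length).sum = ∑ a ∈ L.alph, (L.rule a).length :=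
      Finset.sum_map_toList _ _
    have hcard : L.alph.card ≤ ∑ a ∈ L.alph, (L.rule a).length := by
      rw [Finset.card_eq_sum_ones]
      exact Finset.sum_le_sum fun a ha => List.length_pos_iff.2 (h1 a ha).1
    simp only [List.map_cons, List.length_map, List.map_map, List.sum_cons, List.length_cons,
      Function.comp_def, hsum, hlen, LSystem.size]
    omega
  · obtain ⟨-, hgen⟩ := hg
    unfold decodeLSystem
    simp only [List.getD_cons_succ, List.getD_cons_zero, List.map_map, Function.comp_def,
      Nat.pred_succ]
    obtain ⟨hin, hmap⟩ := map_morphPow (φ := L.rule) (e := e)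
      (ψ := fun i => ((l.map fun a => (L.rule a).map fun a => e a + 1).getD i []).map Nat.pred)
      (fun a ha => (h1 a ha).2) (fun a ha => by
        rw [hget _ _ a ha]
        simp) L.depth h4
    rw [← hmap, List.map_map]
    have hcode : (morphPow L.rule L.depth L.start).map
        ((fun i => (l.map fun a => if L.code a = 1 then 2 else 1).getD i 0 - 1) ∘ e) =
        ((morphPow L.rule L.depth L.start).map L.code).map fun c => if c = 1 then 1 else 0 := by
      rw [List.map_map]
      refine List.map_congr_left fun a ha => ?_
      simp only [Function.comp]
      rw [hget _ _ a (hin a ha)]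
      split_ifs <;> rfl
    -- Replacing every code other than `1` by `0` leaves the binary prefix `w` unchanged, whatever
    -- the codes after position `n` are.
    rw [hcode, ← List.map_take, ← hgen]
    conv_rhs => rw [← List.map_id w]
    refine List.map_congr_left fun a ha => ?_
    have := hw a ha
    interval_cases a <;> simp

theorem length_intercalate_le (ls : List (List ℕ)) :
    ([0].intercalate ls).length ≤ (ls.map List.length).sum + ls.length := by
  induction ls with
  | nil => simp
  | cons l ls ih =>
    cases ls with
    | nil => simp
    | cons l' ls =>
      rw [List.intercalate_cons_cons]
      simp only [List.length_append, List.map_cons, List.sum_cons, List.length_cons,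
        List.length_nil] at *
      omega

theorem mem_intercalate {ls : List (List ℕ)} {x : ℕ} (h : x ∈ [0].intercalate ls) :
    x = 0 ∨ ∃ l ∈ ls, x ∈ l := by
  induction ls with
  | nil => simp at h
  | cons l ls ih =>
    cases ls with
    | nil => right; simpa using h
    | cons l' ls =>
      rw [List.intercalate_cons_cons, List.mem_append, List.mem_append] at h
      rcases h with (h | h) | h
      · exact Or.inr ⟨l, by simp, h⟩
      · left; simpa using h
      · rcases ih h with h | ⟨t, ht, hx⟩
        · exact Or.inl h
        · exact Or.inr ⟨t, List.mem_cons_of_mem _ ht, hx⟩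

/-- A string of this kind is recovered from the separated code word, padded with zeros to length
`2s` over `{0, …, s}`, its true length, and the numbers `d ≤ N^K` and `n ≤ N`. -/
theorem exists_finset_lSystem_strings (K N s : ℕ) : ∃ F : Finset Str,
    F.card ≤ ((2 * s + 1) * (s + 1) ^ (2 * s)) * ((N ^ K + 1) * (N + 1)) ∧
    ∀ (L : LSystem) (w : Str), L.Valid → L.depth ≤ L.len ^ K → L.len ≤ N → L.Generates w →
      L.size ≤ s → (∀ a ∈ w, a < 2) → w ∈ F := by
  classical
  let f : (Fin (2 * s + 1) × (Fin (2 * s) → Fin (s + 1))) × (Fin (N ^ K + 1) × Fin (N + 1)) → Str :=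
    fun x => decodeLSystem (((List.ofFn fun i => (x.1.2 i : ℕ)).take x.1.1).splitOn 0) x.2.1 x.2.2
  refine ⟨Finset.univ.image f, Finset.card_image_le.trans (by simp), ?_⟩
  intro L w hL hd hn hg hs hw
  obtain ⟨ls, hne, hpos, hlen, hdec⟩ := hL.exists_decode hg hw
  set xs := [0].intercalate ls with hxs
  have hxl : xs.length ≤ 2 * s := (length_intercalate_le ls).trans (by omega)
  have hxm : ∀ i, xs.getD i 0 < s + 1 := by
    intro i
    by_cases hi : i < xs.length
    · have : xs.getD i 0 ∈ xs := by simp [List.getD, hi]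
      rcases mem_intercalate this with h | ⟨l, hl, h⟩
      · omega
      · have := (hpos l hl _ h).2
        omega
    · simp [List.getD, List.getElem?_eq_none (not_lt.1 hi)]
  have hdN : L.depth ≤ N ^ K := hd.trans (Nat.pow_le_pow_left hn K)
  refine Finset.mem_image.2 ⟨((⟨xs.length, by omega⟩, fun i => ⟨xs.getD i 0, hxm i⟩),
    (⟨L.depth, by omega⟩, ⟨L.len, by omega⟩)), Finset.mem_univ _, ?_⟩
  have : ((List.ofFn fun i : Fin (2 * s) => xs.getD i 0).take xs.length) = xs := by
    apply List.ext_getElem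
    · simp; omega
    · intro i h1 h2
      simp [List.getD, h2]
  simp only [f, this]
  rw [hxs, List.splitOn_intercalate 0 (fun l hl h0 => by
    have := (hpos l hl 0 h0).1; omega) hne]
  exact hdec

/-- Among sufficiently many binary strings of length at most `N`, one is not generated by a small
L-system. -/
theorem exists_lt_ell {K N s : ℕ} (hK : 1 ≤ K) {S : Finset Str}
    (hS : ∀ w ∈ S, w ≠ [] ∧ w.length ≤ N ∧ ∀ a ∈ w, a < 2)
    (hcard : ((2 * s + 1) * (s + 1) ^ (2 * s)) * ((N ^ K + 1) * (N + 1)) < S.card) :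
    ∃ w ∈ S, s < ell K w := by
  obtain ⟨F, hF, hmem⟩ := exists_finset_lSystem_strings K N s
  obtain ⟨w, hwS, hwF⟩ : ∃ w ∈ S, w ∉ F := by
    by_contra! h
    have := Finset.card_le_card (s := S) (t := F) h
    omega
  refine ⟨w, hwS, ?_⟩
  by_contra! hle
  obtain ⟨h1, h2, h3⟩ := hS w hwS
  obtain ⟨L, hL, hd, hg, hs⟩ := exists_lSystem_eq_ell hK h1
  have hlen : L.len = w.length := by rw [hg.2]; simp [hg.1]
  exact hwF (hmem L w hL hd (by omega) hg (by omega) h3)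

/-! ### Strings of blocks `0^k 1` -/

/-- The string `0^{k₁} 1 0^{k₂} 1 ⋯`. -/
def blockStr (ks : List ℕ) : Str := ks.flatMap fun k => List.replicate k 0 ++ [1]

theorem blockStr_cons (k : ℕ) (ks : List ℕ) :
    blockStr (k :: ks) = List.replicate k 0 ++ 1 :: blockStr ks := by
  simp [blockStr]

theorem length_blockStr (ks : List ℕ) : (blockStr ks).length = ks.sum + ks.length := by
  induction ks with
  | nil => rfl
  | cons k ks ih => rw [blockStr_cons]; simp [ih]; omega

theorem lt_two_of_mem_blockStr {ks : List ℕ} {a : ℕ} (h : a ∈ blockStr ks) : a < 2 := by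
  obtain ⟨k, -, h⟩ := List.mem_flatMap.1 h
  rcases List.mem_append.1 h with h | h
  · rw [List.eq_of_mem_replicate h]; omega
  · rw [List.mem_singleton.1 h]; omega

theorem blockStr_injective : Function.Injective blockStr := by
  have key : ∀ (a b : ℕ) (s r : Str),
      List.replicate a 0 ++ 1 :: s = List.replicate b 0 ++ 1 :: r → a = b ∧ s = r := by
    intro a
    induction a with
    | zero =>
      rintro (_ | b) s r h
      · simpa using h
      · simp [List.replicate_succ] at h
    | succ a ih =>
      rintro (_ | b) s r h
      · simp [List.replicate_succ] at h
      · have := ih b s r (by simpa [List.replicate_succ] using h)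
        exact ⟨by omega, this.2⟩
  intro ks
  induction ks with
  | nil =>
    rintro (_ | ⟨l, ls⟩) h
    · rfl
    · simp [blockStr] at h
  | cons k ks ih =>
    rintro (_ | ⟨l, ls⟩) h
    · simp [blockStr] at h
    · rw [blockStr_cons, blockStr_cons] at h
      obtain ⟨rfl, htail⟩ := key _ _ _ _ h
      rw [ih htail]

theorem count_one_blockStr (ks : List ℕ) : (blockStr ks).countP (· ≠ 0) = ks.length := by
  induction ks with
  | nil => rfl
  | cons k ks ih =>
    rw [blockStr_cons, List.countP_append, List.countP_cons, ih]
    simp [List.countP_replicate]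

/-! Run-length straight-line programs -/

theorem values_map_run (ks : List ℕ) :
    Prog.values (ks.map fun k => .run (.term 0) k) = ks.map fun k => List.replicate k 0 := by
  induction ks using List.reverseRecOn with
  | nil => rfl
  | append_singleton ks k ih =>
    rw [List.map_append, List.map_singleton, values_append_singleton, ih, List.map_append]
    simp [GRule.eval, GSym.eval]

/-- Each block costs a run rule of size `2`, which is why its length must exceed `1`, and two
symbols in the final sequence. -/
theorem rlslp_blockStr_le {ks : List ℕ} (hks : ∀ k ∈ ks, 1 < k) (hne : ks ≠ []) :
    rlslp (blockStr ks) ≤ 4 * ks.length := by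
  set p : Prog := ks.map fun k => .run (.term 0) k with hp
  set xs : List GSym := (List.range ks.length).flatMap fun i => [.var i, .term 1] with hxs
  have hlen : xs.length = 2 * ks.length := by
    simp [hxs, List.length_flatMap, mul_comm]
  have hsize : Prog.size (p ++ [.seq xs]) = 4 * ks.length := by
    simp [Prog.size, hp, Function.comp_def, GRule.size, hlen]; omega
  refine Nat.sInf_le ⟨p ++ [.seq xs], ?_, ⟨?_, ?_⟩, hsize⟩
  · intro r hr
    rcases List.mem_append.1 hr with hr | hr
    · obtain ⟨k, hk, rfl⟩ := List.mem_map.1 hr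
      exact Or.inr (hks k hk)
    · rw [List.mem_singleton.1 hr]
      left
      simp only [GRule.IsPlain]
      rw [← List.length_pos_iff, hlen]
      have := List.length_pos_iff.2 hne
      omega
  · intro i r hr j hj
    by_cases hi : i < p.length
    · rw [List.getElem?_append_left hi] at hr
      have hr := List.mem_of_getElem? hr
      obtain ⟨k, -, rfl⟩ := List.mem_map.1 hr
      simp [GRule.syms] at hj
    · rw [List.getElem?_append_right (not_lt.1 hi)] at hr
      have hr := List.mem_of_getElem? hr
      rw [List.mem_singleton.1 hr] at hj
      have : j < ks.length := by simpa [GRule.syms, hxs] using hj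
      simp [hp] at hi
      omega
  · rw [values_append_singleton, hp, values_map_run]
    simp only [GRule.eval, hxs, List.flatMap_assoc, List.getLast?_append, List.getLast?_singleton,
      Option.some_or, Option.some.injEq]
    have : ks = (List.range ks.length).map fun i => ks.getD i 0 := by
      apply List.ext_getElem
      · simp
      · intro i h1 h2; simp [List.getD, h1]
    conv_rhs => rw [blockStr, this, List.flatMap_map]
    refine List.flatMap_congr fun i hi => ?_
    rw [List.mem_range] at hi
    simp [GSym.eval, List.getD, hi]

/-! Burrows-Wheeler transform -/

/-- Every run of zeros other than an initial one is preceded by a nonzero symbol. -/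
theorem numRuns_le_countP (l : List ℕ) :
    numRuns l ≤ 2 * l.countP (· ≠ 0) + if l.head? = some 0 then 1 else 0 := by
  induction l with
  | nil => simp [numRuns]
  | cons a l ih =>
    cases l with
    | nil => by_cases h : a = 0 <;> simp [numRuns_singleton, h]
    | cons b l =>
      rw [numRuns_cons_cons]
      rw [List.countP_cons]
      by_cases ha : a = 0 <;> by_cases hb : b = 0 <;> simp [ha, hb] at ih ⊢
      · omega
      · split_ifs <;> omega
      · omega
      · split_ifs <;> omega

/-- Before sorting, the last symbols of the rotations spell a rotation of `w`. Hence a string with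
few ones has a transform with few ones, and so with few runs. -/
theorem bwt_perm (w : Str) : (bwt w).Perm w := by
  rcases eq_or_ne w [] with rfl | hw
  · simp [bwt]
  have hn := List.length_pos_iff.2 hw
  rw [bwt_eq_map]
  refine ((List.perm_insertionSort _ _).map _).trans ?_
  have : ((List.range w.length).map fun i => w.rotate i).map (fun u => u.getLastD 0) =
      w.rotate (w.length - 1) := by
    apply List.ext_getElem
    · simp
    · intro i h1 h2
      simp only [List.length_rotate] at h2
      simp only [List.getElem_map, List.getElem_range, List.getElem_rotate,
        List.getLastD_eq_getLast?, List.getLast?_eq_getElem?, List.length_rotate]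
      rw [List.getElem?_eq_getElem (by simp; omega), Option.getD_some, List.getElem_rotate]
      congr 2
      omega
  rw [this]
  exact List.rotate_perm _ _

theorem bwtRuns_blockStr_le (ks : List ℕ) : bwtRuns (blockStr ks) ≤ 2 * ks.length + 1 := by
  have h1 := numRuns_le_countP (bwt (blockStr ks))
  rw [(bwt_perm _).countP_eq, count_one_blockStr] at h1
  have : bwtRuns (blockStr ks) = numRuns (bwt (blockStr ks)) := rfl
  rw [this]
  split_ifs at h1 <;> omega

/-! Greedy parsings -/

/-- If every phrase of any greedy parsing passes a checkpoint, the number of phrases is at most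
the number of checkpoints. -/
theorem greedySize_le_card {Copy : Str → List Str → Str → Prop} {w : Str} (C : Finset ℕ)
    (h : ∀ ps, IsGreedyParse Copy w ps → ∀ prev x post, ps = prev ++ x :: post →
      ∃ c ∈ C, prev.flatten.length < c ∧ c ≤ prev.flatten.length + x.length) :
    greedySize Copy w ≤ C.card := by
  obtain ⟨ps, hps, hl⟩ := exists_greedySize_eq Copy w
  rw [← hl]
  have key : ∀ post prev, ps = prev ++ post →
      post.length ≤ (C.filter (prev.flatten.length < ·)).card := by
    intro post
    induction post with
    | nil => intro prev _; simp
    | cons x post ih =>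
      intro prev hp
      have h1 := ih (prev ++ [x]) (by simp [hp])
      obtain ⟨c, hc, hc1, hc2⟩ := h ps hps prev x post hp
      have h2 : C.filter ((prev ++ [x]).flatten.length < ·) ⊂
          C.filter (prev.flatten.length < ·) := by
        rw [Finset.ssubset_iff_of_subset]
        · refine ⟨c, by simp [hc] at hc1 ⊢; omega, ?_⟩
          simp at hc2 ⊢
          intro _; omega
        · intro a ha
          simp at ha ⊢
          exact ⟨ha.1, by omega⟩
      have := Finset.card_lt_card h2
      simp only [List.length_cons]
      omega
  exact (key ps [] rfl).trans (Finset.card_filter_le _ _)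

/-- The positions of the symbol `1` in a string of blocks. -/
def onesPos : List ℕ → Finset ℕ
  | [] => ∅
  | k :: ks => insert k ((onesPos ks).image (k + 1 + ·))

theorem card_onesPos_le (ks : List ℕ) : (onesPos ks).card ≤ ks.length := by
  induction ks with
  | nil => simp [onesPos]
  | cons k ks ih =>
    refine (Finset.card_insert_le _ _).trans ?_
    have := Finset.card_image_le (s := onesPos ks) (f := (k + 1 + ·))
    simp only [List.length_cons]; omega

theorem drop_blockStr_cons_of_le {k p : ℕ} (h : p ≤ k) (ks : List ℕ) :
    (blockStr (k :: ks)).drop p = List.replicate (k - p) 0 ++ 1 :: blockStr ks := by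
  rw [blockStr_cons, List.drop_append_of_le_length (by simpa using h), List.drop_replicate]

theorem exists_drop_blockStr {ks : List ℕ} {M p : ℕ} (hM : ∀ k ∈ ks, k < M)
    (hp : p < (blockStr ks).length) : ∃ j < M, ∃ t,
      (blockStr ks).drop p = List.replicate j 0 ++ 1 :: t ∧ p + j ∈ onesPos ks := by
  induction ks generalizing p with
  | nil => simp [blockStr] at hp
  | cons k ks ih =>
    by_cases h : p ≤ k
    · refine ⟨k - p, by have := hM k (by simp); omega, blockStr ks,
        drop_blockStr_cons_of_le h ks, ?_⟩
      rw [Nat.add_sub_cancel' h]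
      simp [onesPos]
    · rw [length_blockStr, List.sum_cons, List.length_cons] at hp
      obtain ⟨j, hj, t, h1, h2⟩ := @ih (p - (k + 1)) (fun k h => hM k (by simp [h]))
        (by rw [length_blockStr]; omega)
      refine ⟨j, hj, t, ?_, ?_⟩
      · rw [← h1, blockStr_cons, List.drop_append, List.drop_eq_nil_of_le (by simp; omega),
          List.length_replicate, List.nil_append,
          show p - k = (p - (k + 1)) + 1 by omega, List.drop_succ_cons]
      · refine Finset.mem_insert_of_mem (Finset.mem_image.2 ⟨_, h2, ?_⟩)
        omega

/-- Only at position `0` does a full run of `M` zeros start. From any later position the zeros up to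
the next `1` number fewer than `M`, so they also occur at the start of the string. -/
theorem exists_drop_blockStr_cons {ks : List ℕ} {M p : ℕ} (hM : ∀ k ∈ ks, k < M)
    (hp0 : 0 < p) (hp : p < (blockStr (M :: ks)).length) : ∃ j < M, ∃ t,
      (blockStr (M :: ks)).drop p = List.replicate j 0 ++ 1 :: t ∧ p + j ∈ onesPos (M :: ks) := by
  by_cases h : p ≤ M
  · refine ⟨M - p, by omega, blockStr ks, drop_blockStr_cons_of_le h ks, ?_⟩
    rw [Nat.add_sub_cancel' h]
    simp [onesPos]
  · have hlen := length_blockStr ks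
    rw [length_blockStr, List.sum_cons, List.length_cons] at hp
    obtain ⟨j, hj, t, h1, h2⟩ := @exists_drop_blockStr ks M (p - (M + 1)) hM (by omega)
    refine ⟨j, hj, t, ?_, ?_⟩
    · rw [← h1, blockStr_cons, List.drop_append, List.drop_eq_nil_of_le (by simp; omega),
        List.length_replicate, List.nil_append,
        show p - M = (p - (M + 1)) + 1 by omega, List.drop_succ_cons]
    · refine Finset.mem_insert_of_mem (Finset.mem_image.2 ⟨_, h2, ?_⟩)
      omega

theorem replicate_prefix_replicate_append {j k : ℕ} (h : j ≤ k) (t : Str) :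
    List.replicate j 0 <+: List.replicate k 0 ++ t := by
  obtain ⟨d, rfl⟩ := Nat.exists_eq_add_of_le h
  exact ⟨List.replicate d 0 ++ t, by rw [List.replicate_add, List.append_assoc]⟩

theorem replicate_append_lt {j k : ℕ} (h : j < k) (s t : Str) :
    List.replicate k 0 ++ s < List.replicate j 0 ++ 1 :: t := by
  induction j generalizing k with
  | zero =>
    obtain ⟨k, rfl⟩ : ∃ e, k = e + 1 := ⟨k - 1, by omega⟩
    exact List.cons_lt_cons_iff.2 (Or.inl one_pos)
  | succ j ih =>
    obtain ⟨k, rfl⟩ : ∃ e, k = e + 1 := ⟨k - 1, by omega⟩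
    exact List.cons_lt_cons_iff.2 (Or.inr ⟨rfl, ih (by omega)⟩)

/-- The greedy parsing of a string of blocks has few phrases if its first block of zeros is
parsed well and all shorter blocks of zeros may be copied after it. -/
theorem greedySize_blockStr_le {Copy : Str → List Str → Str → Prop} {M : ℕ} {ks : List ℕ}
    (hM : ∀ k ∈ ks, k < M) (E : Finset ℕ) (hE : 1 ∈ E)
    (h : ∀ ps, IsGreedyParse Copy (blockStr (M :: ks)) ps → ∀ prev x post, ps = prev ++ x :: post →
      0 < prev.flatten.length →
      (∃ c ∈ E, prev.flatten.length < c ∧ c ≤ prev.flatten.length + x.length) ∨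
      (∃ j, prev.flatten.length + j = M ∧ j ≤ x.length) ∨
      ∀ j < M, 0 < j → List.replicate j 0 <+: x ++ post.flatten →
        Copy (blockStr (M :: ks)) prev (List.replicate j 0)) :
    greedySize Copy (blockStr (M :: ks)) ≤ E.card + 2 * (ks.length + 1) := by
  -- The checkpoints are `E`, the positions of ones and their successors. A phrase that starts on a
  -- `1` passes the successor; one that starts on a zero and may copy the zeros ahead reaches the
  -- next `1`.
  have hcard : (E ∪ (onesPos (M :: ks) ∪ (onesPos (M :: ks)).image (· + 1))).card ≤
      E.card + 2 * (ks.length + 1) := by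
    have h1 := card_onesPos_le (M :: ks)
    rw [List.length_cons] at h1
    have h2 := Finset.card_image_le (s := onesPos (M :: ks)) (f := (· + 1))
    have h3 := Finset.card_union_le (onesPos (M :: ks)) ((onesPos (M :: ks)).image (· + 1))
    have h4 := Finset.card_union_le E (onesPos (M :: ks) ∪ (onesPos (M :: ks)).image (· + 1))
    omega
  refine (greedySize_le_card _ fun ps hps prev x post hp => ?_).trans hcard
  obtain ⟨hx, -, hmax⟩ := hps.2 prev x post hp
  have hx1 : 0 < x.length := List.length_pos_iff.2 hx
  have hw : (blockStr (M :: ks)).drop prev.flatten.length = x ++ post.flatten := by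
    rw [← hps.1, hp]; simp
  have hplt : prev.flatten.length < (blockStr (M :: ks)).length := by
    have := congrArg List.length hw
    rw [List.length_drop, List.length_append] at this
    omega
  rcases Nat.eq_zero_or_pos prev.flatten.length with h0 | h0
  · exact ⟨1, Finset.mem_union_left _ hE, by omega, by omega⟩
  obtain ⟨j, hj, t, hdrop, hmem⟩ := exists_drop_blockStr_cons hM h0 hplt
  rcases Nat.eq_zero_or_pos j with rfl | hj0
  · refine ⟨prev.flatten.length + 1, ?_, by omega, by omega⟩
    exact Finset.mem_union_right _ (Finset.mem_union_right _ (Finset.mem_image.2 ⟨_, hmem, rfl⟩))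
  rcases h ps hps prev x post hp h0 with ⟨c, hc, h1⟩ | ⟨i, hi, hix⟩ | hcopy
  · exact ⟨c, Finset.mem_union_left _ hc, h1⟩
  · rcases Nat.eq_zero_or_pos i with rfl | hi0
    · have := drop_blockStr_cons_of_le (show prev.flatten.length ≤ M by omega) ks
      rw [hdrop, show M - prev.flatten.length = 0 by omega] at this
      obtain ⟨j, rfl⟩ : ∃ e, j = e + 1 := ⟨j - 1, by omega⟩
      simp [List.replicate_succ] at this
    · refine ⟨M, ?_, by omega, by omega⟩
      exact Finset.mem_union_right _ (Finset.mem_union_left _ (by simp [onesPos]))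
  · have hpre : List.replicate j 0 <+: x ++ post.flatten := by
      rw [← hw, hdrop]; exact List.prefix_append _ _
    have := hmax _ hpre (hcopy j hj hj0 hpre)
    rw [List.length_replicate] at this
    exact ⟨_, Finset.mem_union_right _ (Finset.mem_union_left _ hmem), by omega, by omega⟩

theorem lz_blockStr_le {M : ℕ} {ks : List ℕ} (hM : ∀ k ∈ ks, k < M) :
    lz (blockStr (M :: ks)) ≤ 1 + 2 * (ks.length + 1) := by
  refine (greedySize_blockStr_le hM {1} (by simp) ?_).trans (by simp)
  intro ps _ prev x post _ h0
  refine Or.inr (Or.inr fun j hj _ _ => ⟨0, h0, ?_⟩)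
  rw [List.drop_zero, blockStr_cons]
  exact replicate_prefix_replicate_append hj.le _

/-- Having the most leading zeros, the whole string is the smallest of its suffixes, so it is an
admissible source for every later phrase. -/
theorem lexParse_blockStr_le {M : ℕ} {ks : List ℕ} (hM : ∀ k ∈ ks, k < M) :
    lexParse (blockStr (M :: ks)) ≤ 1 + 2 * (ks.length + 1) := by
  refine (greedySize_blockStr_le hM {1} (by simp) ?_).trans (by simp)
  intro ps hps prev x post hp h0
  refine Or.inr (Or.inr fun j hj _ hpre => ⟨0, ?_, ?_, ?_⟩)
  · rw [length_blockStr]; simp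
  · obtain ⟨hx, -, -⟩ := hps.2 prev x post hp
    have hx1 : 0 < x.length := List.length_pos_iff.2 hx
    have hplt : prev.flatten.length < (blockStr (M :: ks)).length := by
      rw [← hps.1, hp]; simp; omega
    obtain ⟨i, hi, t, hdrop, -⟩ := exists_drop_blockStr_cons hM h0 hplt
    rw [hdrop, List.drop_zero, blockStr_cons]
    exact replicate_append_lt hi _ _
  · rw [List.drop_zero, blockStr_cons]
    exact replicate_prefix_replicate_append hj.le _

/-- The powers of two up to `2 ^ e`. -/
def powersOfTwo (e : ℕ) : Finset ℕ := (Finset.range (e + 1)).image (2 ^ ·)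

theorem one_mem_powersOfTwo (e : ℕ) : 1 ∈ powersOfTwo e :=
  Finset.mem_image.2 ⟨0, by simp, by simp⟩

theorem card_powersOfTwo_le (e : ℕ) : (powersOfTwo e).card ≤ e + 1 :=
  Finset.card_image_le.trans (by simp)

theorem exists_mem_powersOfTwo {e p : ℕ} (h0 : 0 < p) (hp : p < 2 ^ e) :
    ∃ c ∈ powersOfTwo e, p < c ∧ c ≤ p + p := by
  refine ⟨2 ^ (Nat.log 2 p + 1), Finset.mem_image.2 ⟨_, ?_, rfl⟩,
    Nat.lt_pow_succ_log_self (by norm_num) p, ?_⟩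
  · have := (Nat.log_lt_iff_lt_pow (by norm_num) (by omega)).2 hp
    rw [Finset.mem_range]; omega
  · have := Nat.pow_log_le_self 2 (x := p) (by omega)
    rw [pow_succ]; omega

/-- The zeros of the first block may be copied from themselves, which doubles the parsed part. -/
theorem doubling_phrase {Copy : Str → List Str → Str → Prop} {e : ℕ} {ks : List ℕ} {ps : List Str}
    (hps : IsGreedyParse Copy (blockStr (2 ^ e :: ks)) ps) {prev : List Str} {x : Str}
    {post : List Str} (hp : ps = prev ++ x :: post) (h0 : 0 < prev.flatten.length)
    (hlt : prev.flatten.length < 2 ^ e)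
    (hcopy : ∀ j ≤ prev.flatten.length, Copy (blockStr (2 ^ e :: ks)) prev (List.replicate j 0)) :
    (∃ c ∈ powersOfTwo e, prev.flatten.length < c ∧ c ≤ prev.flatten.length + x.length) ∨
      (∃ j, prev.flatten.length + j = 2 ^ e ∧ j ≤ x.length) := by
  obtain ⟨-, -, hmax⟩ := hps.2 prev x post hp
  have hw : (blockStr (2 ^ e :: ks)).drop prev.flatten.length = x ++ post.flatten := by
    rw [← hps.1, hp]; simp
  rw [drop_blockStr_cons_of_le hlt.le] at hw
  have := hmax (List.replicate (min prev.flatten.length (2 ^ e - prev.flatten.length)) 0)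
    (by rw [← hw]; exact replicate_prefix_replicate_append (min_le_right _ _) _)
    (hcopy _ (min_le_left _ _))
  rw [List.length_replicate] at this
  rcases le_total prev.flatten.length (2 ^ e - prev.flatten.length) with h | h
  · left
    rw [min_eq_left h] at this
    obtain ⟨c, hc, h1, h2⟩ := exists_mem_powersOfTwo h0 hlt
    exact ⟨c, hc, h1, by omega⟩
  · right
    rw [min_eq_right h] at this
    exact ⟨_, Nat.add_sub_cancel' hlt.le, this⟩

theorem flatten_eq_take {w : Str} {ps prev post : List Str} (hw : ps.flatten = w)
    (hp : ps = prev ++ post) : prev.flatten = w.take prev.flatten.length := by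
  rw [← hw, hp]; simp

theorem take_blockStr_cons_of_le {k p : ℕ} (h : p ≤ k) (ks : List ℕ) :
    (blockStr (k :: ks)).take p = List.replicate p 0 := by
  rw [blockStr_cons, List.take_append_of_le_length (by simpa using h), List.take_replicate,
    min_eq_left h]

/-- Without overlaps the first block is built by doubling, at the cost of `e + 1` checkpoints at
powers of two. Afterwards each shorter block of zeros is a factor of the parsed part. -/
theorem lzNo_blockStr_le {e : ℕ} {ks : List ℕ} (hM : ∀ k ∈ ks, k < 2 ^ e) :
    lzNo (blockStr (2 ^ e :: ks)) ≤ (e + 1) + 2 * (ks.length + 1) := by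
  refine (greedySize_blockStr_le hM (powersOfTwo e) (one_mem_powersOfTwo e) ?_).trans
    (Nat.add_le_add_right (card_powersOfTwo_le e) _)
  intro ps hps prev x post hp h0
  have hpre := flatten_eq_take hps.1 hp
  rcases lt_or_ge prev.flatten.length (2 ^ e) with hlt | hge
  · refine (doubling_phrase hps hp h0 hlt fun j hj => ?_).imp_right Or.inl
    rw [hpre, take_blockStr_cons_of_le hlt.le]
    simpa using (replicate_prefix_replicate_append hj []).isInfix
  · refine Or.inr (Or.inr fun j hj _ _ => ?_)
    rw [hpre]
    refine (replicate_prefix_replicate_append hj.le []).isInfix.trans (List.IsPrefix.isInfix ?_)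
    rw [List.append_nil, ← take_blockStr_cons_of_le (le_refl (2 ^ e)) ks]
    exact List.take_prefix_take_left hge

theorem replicate_suffix_replicate {j k : ℕ} (h : j ≤ k) :
    List.replicate j 0 <:+ List.replicate k 0 := by
  obtain ⟨d, rfl⟩ := Nat.exists_eq_add_of_le' h
  exact ⟨List.replicate d 0, by rw [List.replicate_add]⟩

/-- The phrase that reaches the end of the first block cannot go beyond it. It would then be a copy
containing the first `1` of the string, which does not occur earlier. So a phrase ends right after
`0^M`, and all shorter blocks of zeros can be copied from there. -/
theorem exists_phrase_end_lzEnd {M : ℕ} {ks : List ℕ} {ps : List Str}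
    (hps : IsGreedyParse (fun _ prev y => ∃ q, q <+: prev ∧ y <:+ q.flatten)
      (blockStr (M :: ks)) ps) {prev post : List Str} (hp : ps = prev ++ post)
    (hM : M ≤ prev.flatten.length) : ∃ q, q <+: prev ∧ q.flatten.length = M := by
  induction prev using List.reverseRecOn generalizing post with
  | nil => exact ⟨[], List.prefix_refl _, by simp at hM ⊢; omega⟩
  | append_singleton prev x ih =>
    have hp' : ps = prev ++ x :: post := by simp [hp]
    rcases le_or_gt M prev.flatten.length with h | h
    · obtain ⟨q, hq, hl⟩ := ih hp' h
      exact ⟨q, hq.trans (List.prefix_append _ _), hl⟩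
    · refine ⟨prev ++ [x], List.prefix_refl _, le_antisymm ?_ hM⟩
      simp only [List.flatten_append, List.flatten_cons, List.flatten_nil, List.append_nil,
        List.length_append]
      rcases (hps.2 prev x post hp').2.1 with hx | ⟨q, ⟨r, hq⟩, hxq⟩
      · omega
      by_contra! hlt
      have hw : (blockStr (M :: ks)).drop prev.flatten.length = x ++ post.flatten := by
        rw [← hps.1, hp']; simp
      rw [drop_blockStr_cons_of_le h.le] at hw
      have h1 : (1 : ℕ) ∈ x := by
        have : x[M - prev.flatten.length]? = some 1 := by
          rw [← List.getElem?_append_left (l₂ := post.flatten) (by omega), ← hw,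
            List.getElem?_append_right (by simp)]
          simp
        exact List.mem_of_getElem? this
      have h2 : (1 : ℕ) ∈ prev.flatten := by
        rw [← hq, List.flatten_append]
        exact List.mem_append_left _ (hxq.mem h1)
      rw [flatten_eq_take hps.1 hp', take_blockStr_cons_of_le h.le] at h2
      exact absurd (List.eq_of_mem_replicate h2) one_ne_zero

theorem lzEnd_blockStr_le {e : ℕ} {ks : List ℕ} (hM : ∀ k ∈ ks, k < 2 ^ e) :
    lzEnd (blockStr (2 ^ e :: ks)) ≤ (e + 1) + 2 * (ks.length + 1) := by
  refine (greedySize_blockStr_le hM (powersOfTwo e) (one_mem_powersOfTwo e) ?_).trans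
    (Nat.add_le_add_right (card_powersOfTwo_le e) _)
  intro ps hps prev x post hp h0
  rcases lt_or_ge prev.flatten.length (2 ^ e) with hlt | hge
  · refine (doubling_phrase hps hp h0 hlt fun j hj => ⟨prev, List.prefix_refl _, ?_⟩).imp_right
      Or.inl
    rw [flatten_eq_take hps.1 hp, take_blockStr_cons_of_le hlt.le]
    exact replicate_suffix_replicate hj
  · refine Or.inr (Or.inr fun j hj _ _ => ?_)
    obtain ⟨q, hq, hl⟩ := exists_phrase_end_lzEnd hps hp hge
    refine ⟨q, hq, ?_⟩
    obtain ⟨r, rfl⟩ := hq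
    rw [flatten_eq_take hps.1 (prev := q) (post := r ++ x :: post) (by simp [hp]), hl,
      take_blockStr_cons_of_le le_rfl]
    exact replicate_suffix_replicate hj.le

/-! ### A family of strings of blocks that needs large L-systems -/

/-- A long block followed by `m` shorter ones of lengths greater than `1`. -/
def IsBlockString (m : ℕ) (w : Str) : Prop :=
  ∃ ks : List ℕ, ks.length = m ∧ (∀ k ∈ ks, 1 < k ∧ k < 2 ^ (m + 2)) ∧
    w = blockStr (2 ^ (m + 2) :: ks)

theorem IsBlockString.ne_nil {m : ℕ} {w : Str} (h : IsBlockString m w) : w ≠ [] := by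
  obtain ⟨ks, -, -, rfl⟩ := h
  simp [blockStr]

theorem IsBlockString.lt_two {m : ℕ} {w : Str} (h : IsBlockString m w) : ∀ a ∈ w, a < 2 := by
  obtain ⟨ks, -, -, rfl⟩ := h
  exact fun a ha => lt_two_of_mem_blockStr ha

theorem IsBlockString.lt_length {m : ℕ} {w : Str} (h : IsBlockString m w) : m < w.length := by
  obtain ⟨ks, hl, -, rfl⟩ := h
  rw [length_blockStr, List.length_cons, hl]; omega

theorem IsBlockString.length_le {m : ℕ} {w : Str} (h : IsBlockString m w) :
    w.length ≤ 2 ^ (2 * m + 4) := by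
  obtain ⟨ks, hl, hks, rfl⟩ := h
  have h1 : ks.sum ≤ ks.length * 2 ^ (m + 2) := by
    have := List.sum_le_card_nsmul ks (2 ^ (m + 2)) fun k hk => (hks k hk).2.le
    simpa using this
  rw [length_blockStr, List.length_cons, List.sum_cons]
  rw [hl] at h1 ⊢
  have h2 : m + 1 ≤ 2 ^ m := Nat.lt_two_pow_self
  have h3 : 1 ≤ 2 ^ (m + 2) := Nat.one_le_two_pow
  calc 2 ^ (m + 2) + ks.sum + (m + 1) ≤ (m + 1) * (2 ^ (m + 2) + 2 ^ (m + 2)) := by nlinarith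
    _ ≤ 2 ^ m * (2 ^ (m + 2) + 2 ^ (m + 2)) := Nat.mul_le_mul_right _ h2
    _ = 2 ^ (2 * m + 3) := by rw [← two_mul, ← pow_succ', ← pow_add]; congr 1; omega
    _ ≤ 2 ^ (2 * m + 4) := Nat.pow_le_pow_right (by norm_num) (by omega)

theorem exists_finset_isBlockString (m : ℕ) :
    ∃ S : Finset Str, S.card = 2 ^ (m * m) ∧ ∀ w ∈ S, IsBlockString m w := by
  classical
  have hinj : Function.Injective fun f : Fin m → Fin (2 ^ m) =>
      blockStr (2 ^ (m + 2) :: List.ofFn fun i => (f i : ℕ) + 2) := by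
    intro f g h
    have h := List.ofFn_injective (List.cons.inj (blockStr_injective h)).2
    funext i
    have : (f i : ℕ) + 2 = g i + 2 := congrFun h i
    exact Fin.ext (by omega)
  -- The shift by `2` makes the lengths exceed `1`; they stay at most `2^m + 1`, below the first
  -- block length `2^{m+2}`.
  refine ⟨Finset.univ.image fun f : Fin m → Fin (2 ^ m) =>
      blockStr (2 ^ (m + 2) :: List.ofFn fun i => (f i : ℕ) + 2), ?_, ?_⟩
  · rw [Finset.card_image_of_injective _ hinj]
    simp [pow_mul]
  · intro w hw
    obtain ⟨f, -, rfl⟩ := Finset.mem_image.1 hw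
    refine ⟨_, by simp, ?_, rfl⟩
    intro k hk
    obtain ⟨i, rfl⟩ := List.mem_ofFn.1 hk
    have h1 := (f i).2
    have h2 : 1 ≤ 2 ^ m := Nat.one_le_two_pow
    rw [pow_add]
    omega

theorem pow_four_lt_two_pow {k : ℕ} (hk : 17 ≤ k) : k ^ 4 + 1 ≤ 2 ^ k := by
  induction k, hk using Nat.le_induction with
  | base => norm_num
  | succ k hk ih =>
    have h1 : 17 * k ^ 3 ≤ k ^ 4 := by rw [pow_succ k 3, mul_comm]; exact Nat.mul_le_mul_left _ hk
    have h2 : 17 * k ^ 2 ≤ k ^ 3 := by rw [pow_succ k 2, mul_comm]; exact Nat.mul_le_mul_left _ hk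
    have h3 : 17 * k ≤ k ^ 2 := by rw [sq]; exact Nat.mul_le_mul_right _ hk
    have h4 : (k + 1) ^ 4 = k ^ 4 + 4 * k ^ 3 + 6 * k ^ 2 + 4 * k + 1 := by ring
    rw [pow_succ 2 k]
    omega

/-- Since `k^4 + 1 ≤ 2^k`, the left side is `2` to a power with leading term `2k^5`, against `k^6`
on the right. The condition `K ≤ k` keeps the contribution of the depth at order `k^4`. -/
theorem count_lt_two_pow {K k : ℕ} (hk : 17 ≤ k) (hK : K ≤ k) :
    ((2 * k ^ 4 + 1) * (k ^ 4 + 1) ^ (2 * k ^ 4)) *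
      (((2 ^ (2 * k ^ 3 + 4)) ^ K + 1) * (2 ^ (2 * k ^ 3 + 4) + 1)) < 2 ^ (k ^ 3 * k ^ 3) := by
  have h1 := pow_four_lt_two_pow hk
  have h2 : 2 * k ^ 4 + 1 ≤ 2 ^ (k + 1) := by rw [pow_succ 2 k]; omega
  have h3 : (k ^ 4 + 1) ^ (2 * k ^ 4) ≤ 2 ^ (k * (2 * k ^ 4)) := by
    rw [pow_mul 2]; exact Nat.pow_le_pow_left h1 _
  have succ_le : ∀ a : ℕ, 2 ^ a + 1 ≤ 2 ^ (a + 1) := by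
    intro a
    have : 1 ≤ 2 ^ a := Nat.one_le_two_pow
    rw [pow_succ]; omega
  have h4 : (2 ^ (2 * k ^ 3 + 4)) ^ K + 1 ≤ 2 ^ ((2 * k ^ 3 + 4) * K + 1) := by
    rw [← pow_mul]; exact succ_le _
  calc _ ≤ (2 ^ (k + 1) * 2 ^ (k * (2 * k ^ 4))) *
        (2 ^ ((2 * k ^ 3 + 4) * K + 1) * 2 ^ (2 * k ^ 3 + 4 + 1)) :=
      Nat.mul_le_mul (Nat.mul_le_mul h2 h3) (Nat.mul_le_mul h4 (succ_le _))
    _ = 2 ^ (k + 1 + k * (2 * k ^ 4) + ((2 * k ^ 3 + 4) * K + 1 + (2 * k ^ 3 + 4 + 1))) := by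
      simp only [← pow_add]
    _ < 2 ^ (k ^ 3 * k ^ 3) := by
      refine Nat.pow_lt_pow_right (by norm_num) ?_
      have a1 : (2 * k ^ 3 + 4) * K ≤ (2 * k ^ 3 + 4) * k := Nat.mul_le_mul_left _ hK
      have a2 : k ≤ k ^ 5 := Nat.le_self_pow (by norm_num) k
      have a3 : k ^ 3 ≤ k ^ 5 := Nat.pow_le_pow_right (by omega) (by norm_num)
      have a4 : k ^ 4 ≤ k ^ 5 := Nat.pow_le_pow_right (by omega) (by norm_num)
      have a5 : 17 * k ^ 5 ≤ k ^ 3 * k ^ 3 := by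
        rw [← pow_add, show 3 + 3 = 5 + 1 by rfl, pow_succ, mul_comm]
        exact Nat.mul_le_mul_left _ hk
      have a6 : (2 * k ^ 3 + 4) * k = 2 * k ^ 4 + 4 * k := by ring
      have a7 : k * (2 * k ^ 4) = 2 * k ^ 5 := by ring
      omega

theorem exists_isBlockString_pow_lt_ell {K : ℕ} (hK : 1 ≤ K) :
    ∃ w : ℕ → Str, (∀ k, IsBlockString (k ^ 3) (w k)) ∧
      ∀ k, 17 ≤ k → K ≤ k → k ^ 4 < ell K (w k) := by
  have : ∀ k, ∃ w, IsBlockString (k ^ 3) w ∧ (17 ≤ k → K ≤ k → k ^ 4 < ell K w) := by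
    intro k
    obtain ⟨S, hS, hw⟩ := exists_finset_isBlockString (k ^ 3)
    by_cases hk : 17 ≤ k ∧ K ≤ k
    · obtain ⟨w, h1, h2⟩ := exists_lt_ell (N := 2 ^ (2 * k ^ 3 + 4)) (s := k ^ 4) hK (S := S)
        (fun w h => ⟨(hw w h).ne_nil, (hw w h).length_le, (hw w h).lt_two⟩)
        (by rw [hS]; exact count_lt_two_pow hk.1 hk.2)
      exact ⟨w, hw w h1, fun _ _ => h2⟩
    -- Small indices do not affect the asymptotics, so any block string will do.
    · obtain ⟨w, h1⟩ : S.Nonempty := by rw [← Finset.card_pos, hS]; positivity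
      exact ⟨w, hw w h1, fun h h' => absurd ⟨h, h'⟩ hk⟩
  choose w hw using this
  exact ⟨w, fun k => (hw k).1, fun k => (hw k).2⟩

theorem smallerOnSomeFamily_of_le {K : ℕ} (hK : 1 ≤ K) (μ : Str → ℝ) (h0 : ∀ w, 0 ≤ μ w)
    (hμ : ∀ m w, IsBlockString m w → μ w ≤ 8 * (m + 1)) :
    SmallerOnSomeFamily μ fun w => (ell K w : ℝ) := by
  obtain ⟨w, h1, h2⟩ := exists_isBlockString_pow_lt_ell hK
  refine ⟨Finset.range 2, w, fun k a ha => Finset.mem_range.2 ((h1 k).lt_two a ha), ?_, ?_⟩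
  · refine tendsto_atTop_mono (fun k => ?_) tendsto_id
    have := (h1 k).lt_length
    have : k ≤ k ^ 3 := Nat.le_self_pow (by norm_num) k
    simp only [id]; omega
  · have hO1 : (fun k => μ (w k)) =O[atTop] fun k : ℕ => (k : ℝ) ^ 3 := by
      -- For `k ≥ 1`, `8(k³ + 1) ≤ 16k³`.
      refine IsBigO.of_bound 16 ?_
      filter_upwards [eventually_ge_atTop 1] with k hk
      have hk3 : (1 : ℝ) ≤ (k : ℝ) ^ 3 := one_le_pow₀ (by exact_mod_cast hk)
      have := hμ _ _ (h1 k)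
      push_cast at this
      rw [Real.norm_of_nonneg (h0 _), Real.norm_of_nonneg (by positivity)]
      linarith
    have hO2 : (fun k : ℕ => (k : ℝ) ^ 4) =O[atTop] fun k => (ell K (w k) : ℝ) := by
      refine IsBigO.of_bound 1 ?_
      filter_upwards [eventually_ge_atTop 17, eventually_ge_atTop K] with k hk hk'
      have : (k : ℝ) ^ 4 ≤ ell K (w k) := by exact_mod_cast (h2 k hk hk').le
      rw [Real.norm_of_nonneg (by positivity), Real.norm_of_nonneg (by positivity)]
      linarith
    have ho : (fun k : ℕ => (k : ℝ) ^ 3) =o[atTop] fun k : ℕ => (k : ℝ) ^ 4 :=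
      (isLittleO_pow_pow_atTop_of_lt (𝕜 := ℝ) (by norm_num : 3 < 4)).comp_tendsto
        tendsto_natCast_atTop_atTop
    exact (hO1.trans_isLittleO ho).trans_isBigO hO2

/-! ### Combining the two families into incomparability -/

/-- Both families are independent of the kind of measure; all that is asked of `μ` is a lower bound
by `δ` and a linear upper bound on block strings. -/
theorem incomparable_of_bounds {K : ℕ} (hK : 1 ≤ K) (μ : Str → ℝ)
    (hδ : ∀ w, w ≠ [] → delta w ≤ μ w) (h0 : ∀ w, 0 ≤ μ w)
    (hμ : ∀ m w, IsBlockString m w → μ w ≤ 8 * (m + 1)) :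
    Incomparable (fun w => (ell K w : ℝ)) μ :=
  ⟨smallerOnSomeFamily_of_delta_le hK μ hδ, smallerOnSomeFamily_of_le hK μ h0 hμ⟩

theorem incomparable_of_nat_bounds {K : ℕ} (hK : 1 ≤ K) (μ : Str → ℕ)
    (hδ : ∀ w, w ≠ [] → delta w ≤ μ w)
    (hμ : ∀ m w, IsBlockString m w → μ w ≤ 8 * (m + 1)) :
    Incomparable (fun w => (ell K w : ℝ)) fun w => (μ w : ℝ) :=
  incomparable_of_bounds hK _ hδ (fun _ => Nat.cast_nonneg _)
    fun m w h => by exact_mod_cast hμ m w h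

theorem delta_le_of_bms_le {w : Str} {m : ℕ} (h : bms w ≤ m) : delta w ≤ m :=
  (delta_le_gamma w).trans (by exact_mod_cast (gamma_le_bms w).trans h)

theorem IsBlockString.bms_le {m : ℕ} {w : Str} (h : IsBlockString m w) : bms w ≤ 8 * (m + 1) := by
  obtain ⟨ks, rfl, hks, rfl⟩ := h
  refine (bms_le_lz _).trans ((lz_blockStr_le fun k hk => (hks k hk).2).trans ?_)
  omega

theorem IsBlockString.rlslp_le {m : ℕ} {w : Str} (h : IsBlockString m w) :
    rlslp w ≤ 8 * (m + 1) := by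
  obtain ⟨ks, rfl, hks, rfl⟩ := h
  refine (rlslp_blockStr_le ?_ (by simp)).trans (by rw [List.length_cons]; omega)
  intro k hk
  rcases List.mem_cons.1 hk with rfl | hk
  · exact Nat.one_lt_two_pow (by omega)
  · exact (hks k hk).1

end Repet

open Repet in
theorem theorem1 (K : ℕ) (hK : 1 ≤ K) :
    Repet.Incomparable (fun w => (Repet.ell K w : ℝ)) (fun w => Repet.delta w) ∧
    Repet.Incomparable (fun w => (Repet.ell K w : ℝ)) (fun w => (Repet.gamma w : ℝ)) ∧
    Repet.Incomparable (fun w => (Repet.ell K w : ℝ)) (fun w => (Repet.bms w : ℝ)) ∧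
    Repet.Incomparable (fun w => (Repet.ell K w : ℝ)) (fun w => (Repet.lexParse w : ℝ)) ∧
    Repet.Incomparable (fun w => (Repet.ell K w : ℝ)) (fun w => (Repet.collage w : ℝ)) ∧
    Repet.Incomparable (fun w => (Repet.ell K w : ℝ)) (fun w => (Repet.rlslp w : ℝ)) ∧
    Repet.Incomparable (fun w => (Repet.ell K w : ℝ)) (fun w => (Repet.lz w : ℝ)) ∧
    Repet.Incomparable (fun w => (Repet.ell K w : ℝ)) (fun w => (Repet.lzNo w : ℝ)) ∧
    Repet.Incomparable (fun w => (Repet.ell K w : ℝ)) (fun w => (Repet.lzEnd w : ℝ)) ∧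
    Repet.Incomparable (fun w => (Repet.ell K w : ℝ)) (fun w => (Repet.bwtRuns w : ℝ)) ∧
    (∃ C : ℝ, 0 < C ∧ ∀ w : Repet.Str, w ≠ [] →
      (Repet.ell K w : ℝ) ≤ C * (Repet.slp w : ℝ)) ∧
    (∃ c : ℝ, 0 < c ∧ ∀ w : Repet.Str, w ≠ [] →
      c * (Repet.nu K w : ℝ) ≤ (Repet.ell K w : ℝ)) := by
  refine ⟨?_, ?_, ?_, ?_, ?_, ?_, ?_, ?_, ?_, ?_, ⟨7, by norm_num, ?_⟩, ⟨1, one_pos, ?_⟩⟩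
  · refine incomparable_of_bounds hK _ (fun _ _ => le_rfl) (fun _ => NNReal.coe_nonneg _)
      fun m w h => ?_
    exact_mod_cast delta_le_of_bms_le h.bms_le
  · exact incomparable_of_nat_bounds hK _ (fun w _ => delta_le_gamma w)
      fun m w h => (gamma_le_bms w).trans h.bms_le
  · exact incomparable_of_nat_bounds hK _ (fun w _ => delta_le_of_bms_le le_rfl)
      fun m w h => h.bms_le
  · refine incomparable_of_nat_bounds hK _ (fun w _ => delta_le_of_bms_le (bms_le_lexParse w)) ?_
    rintro m w ⟨ks, rfl, hks, rfl⟩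
    refine (lexParse_blockStr_le fun k hk => (hks k hk).2).trans (by omega)
  · exact incomparable_of_nat_bounds hK _ (fun w hw => delta_le_collage hw)
      fun m w h => (collage_le_rlslp h.ne_nil).trans h.rlslp_le
  · refine incomparable_of_nat_bounds hK _ (fun w hw => (delta_le_collage hw).trans ?_)
      fun m w h => h.rlslp_le
    exact_mod_cast collage_le_rlslp hw
  · refine incomparable_of_nat_bounds hK _ (fun w _ => delta_le_of_bms_le (bms_le_lz w)) ?_
    rintro m w ⟨ks, rfl, hks, rfl⟩
    refine (lz_blockStr_le fun k hk => (hks k hk).2).trans (by omega)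
  · refine incomparable_of_nat_bounds hK _ (fun w _ => delta_le_of_bms_le (bms_le_lzNo w)) ?_
    rintro m w ⟨ks, rfl, hks, rfl⟩
    refine (lzNo_blockStr_le fun k hk => (hks k hk).2).trans (by omega)
  · refine incomparable_of_nat_bounds hK _ (fun w _ => delta_le_of_bms_le (bms_le_lzEnd w)) ?_
    rintro m w ⟨ks, rfl, hks, rfl⟩
    refine (lzEnd_blockStr_le fun k hk => (hks k hk).2).trans (by omega)
  · refine incomparable_of_nat_bounds hK _ (fun w hw => delta_le_bwtRuns hw) ?_
    rintro m w ⟨ks, rfl, hks, rfl⟩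
    refine (bwtRuns_blockStr_le _).trans (by rw [List.length_cons]; omega)
  · intro w hw
    exact_mod_cast ell_le_slp hK hw
  · intro w hw
    rw [one_mul]
    exact_mod_cast nu_le_ell hK hw
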